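/- Let $y=(y_n)_{n\ge 1}$ be an aperiodic sequence, i.e. a bounded sequence of real numbers such that for all integers $t\ge 1$ and $l\ge 0$ $$\lim_{n\to\infty}\frac1n\sum_{i=1}^n y_{it+l}=0,$$ and let $N\ge 2$ be an integer. Then for every $\varepsilon>0$ there exists a subshift $\Sigma'$ over $N$ symbols (a closed subset of $\{0,\dots,N-1\}^{\mathbb N}$ invariant under the shift map $T$) such that 1. $(\Sigma',T)$ is strictly ergodic, i.e. minimal ($\Sigma'$ is nonempty and its only closed subsets $A$ with $T(A)\subseteq A$ are $\emptyset$ and $\Sigma'$) and uniquely ergodic (there is exactly one $T$-invariant Borel probability measure on $\Sigma'$); 2. the topological entropy of $(\Sigma',T)$ satisfies $|h(\Sigma')-\log N|<\varepsilon$; 3. $(\Sigma',T)$ is uniformly uncorrelated to $y$: for every continuous function $f:\Sigma'\to\mathbb R$, $$\lim_{n\to\infty}\ \sup_{x\in\Sigma'}\left|\frac1n\sum_{i=1}^n f(T^ix)\,y_i\right|=0.$$ -/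

import Mathlib

/-!
Blocks of level `k + 1` are concatenations of `p ^ 4` blocks of level `k`, which have length `p`.
Fix a word `w` and a bounded weight `z`. When the blocks of level `k` are chosen independently, the
number of occurrences of `w`, counted with the weights `z (i + j)` and diminished by its mean, is a
sum of `p ^ 4` independent centred terms bounded by `p`. By Hoeffding's inequality, all but a tiny
proportion of the concatenations keep this sum below `p ^ 4`, which is `1 / p` times their length,
simultaneously for the first `k + 1` pairs `(w, z)` and for a huge range of starting positions `i`.
Only these concatenations are admitted, so hardly any entropy is lost.

The subshift consists of the sequences all of whose prefixes occur in blocks. Along each of its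
orbits the averages of `1_w * z` agree up to `O(1 / p)` with those of a `p`-periodic sequence times
`z`. If `z` has zero means along arithmetic progressions, the latter tend to `0`, which makes the
subshift uncorrelated to `z`. The weight `z = 1` yields the uniform convergence of the averages of
`1_w`, hence unique ergodicity. As the mean frequency of a word in the blocks of level `k` decreases
by at most twice the proportion of rejected concatenations, every block occurs in every point, which
gives minimality.
-/

open MeasureTheory Filter Topology SymbolicDynamics.FullShift

/-- A real sequence `y₁, y₂, …` (the value `y 0` plays no role) is *aperiodic* if it is bounded and
has zero average along every infinite arithmetic progression. -/
def IsAperiodicSeq (y : ℕ → ℝ) : Prop :=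
  (∃ C : ℝ, ∀ n : ℕ, 1 ≤ n → |y n| ≤ C) ∧
  ∀ t l : ℕ, 1 ≤ t →
    Tendsto (fun n : ℕ => (1 / (n : ℝ)) * ∑ i ∈ Finset.Icc 1 n, y (i * t + l)) atTop (𝓝 0)

/-- The system `(X, T)` is *uniformly uncorrelated* to `y`: for each continuous `f : X → ℝ` the
averages `(1/n) ∑_{i=1}^n f(Tⁱ x) yᵢ` converge to `0` uniformly in `x`. -/
def UniformlyUncorrelated {X : Type*} [TopologicalSpace X] (T : X → X) (y : ℕ → ℝ) : Prop :=
  ∀ f : C(X, ℝ), TendstoUniformly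
    (fun (n : ℕ) (x : X) => (1 / (n : ℝ)) * ∑ i ∈ Finset.Icc 1 n, f (T^[i] x) * y i)
    (fun _ => 0) atTop

/-- The system `(X, T)` is *minimal*: `X` is nonempty and has no closed forward-invariant subsets
other than `∅` and `X`. -/
def IsMinimalSystem {X : Type*} [TopologicalSpace X] (T : X → X) : Prop :=
  Nonempty X ∧ ∀ A : Set X, IsClosed A → Set.MapsTo T A A → A = ∅ ∨ A = Set.univ

/-- The system `(X, T)` is *uniquely ergodic*: it has exactly one invariant Borel probability
measure. -/
def IsUniquelyErgodic {X : Type*} [TopologicalSpace X] [MeasurableSpace X] [BorelSpace X]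
    (T : X → X) : Prop :=
  ∃! μ : Measure X, IsProbabilityMeasure μ ∧ MeasurePreserving T μ μ

/-- *Strictly ergodic* means minimal and uniquely ergodic. -/
def IsStrictlyErgodic {X : Type*} [TopologicalSpace X] [MeasurableSpace X] [BorelSpace X]
    (T : X → X) : Prop :=
  IsMinimalSystem T ∧ IsUniquelyErgodic T

/-- The shift map `(x₀, x₁, …) ↦ (x₁, x₂, …)` restricted to a one-sided subshift. -/
def subshiftMap {A : Type*} [TopologicalSpace A] (S : Subshift A ℕ) : S.carrier → S.carrier :=
  (S.mapsTo 1).restrict (shift 1) S.carrier S.carrier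

/-- The topological entropy of a one-sided subshift over a finite (discrete) alphabet: the
Bowen–Dinaburg entropy of the shift map on the subshift. The uniformity is the one induced from the
product of the discrete uniformities; the subshift being compact, it is the only uniformity
compatible with its topology. -/
noncomputable def subshiftEntropy {N : ℕ} (S : Subshift (Fin N) ℕ) : EReal :=
  letI : UniformSpace (Fin N) := ⊥
  Dynamics.coverEntropy (subshiftMap S) Set.univ

open scoped BigOperators

/-! ### Concentration and finite averages -/

open ProbabilityTheory in
theorem integral_uniformOn_univ {Ω : Type*} [Fintype Ω] [Nonempty Ω] [MeasurableSpace Ω]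
    [MeasurableSingletonClass Ω] (f : Ω → ℝ) :
    ∫ ω, f ω ∂uniformOn Set.univ = 𝔼 ω, f ω := by
  classical
  have := isProbabilityMeasure_uniformOn (Set.finite_univ (α := Ω)) Set.univ_nonempty
  have hsingle (ω : Ω) : (uniformOn (Set.univ : Set Ω)).real {ω} = (Fintype.card Ω : ℝ)⁻¹ := by
    have := uniformOn_apply_finset (s := Finset.univ) (t := {ω})
    simp only [Finset.coe_univ, Finset.coe_singleton] at this
    simp [measureReal_def, this]
  simp [integral_fintype Integrable.of_finite, hsingle, Finset.expect, ← Finset.mul_sum,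
    NNRat.smul_def]

open ProbabilityTheory in
theorem card_le_sum_apply_le {ι Ω : Type*} [Fintype ι] [DecidableEq ι] [Fintype Ω] [Nonempty Ω]
    {g : ι → Ω → ℝ} {M ε : ℝ} (hε : 0 ≤ ε) (hg : ∀ i ω, |g i ω| ≤ M)
    (hmean : ∀ i, 𝔼 ω, g i ω = 0) :
    (Finset.card {v : ι → Ω | ε ≤ ∑ i, g i (v i)} : ℝ) ≤
      Real.exp (-ε ^ 2 / (2 * (Fintype.card ι * M ^ 2))) * Fintype.card (ι → Ω) := by
  classical
  let _ : MeasurableSpace Ω := ⊤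
  have := isProbabilityMeasure_uniformOn (Set.finite_univ (α := Ω)) Set.univ_nonempty
  have hpi : uniformOn (Set.univ : Set (ι → Ω)) = Measure.pi fun _ => uniformOn Set.univ := by
    rw [← uniformOn_pi, Set.pi_univ]
  have hsub (i : ι) : HasSubgaussianMGF (fun v : ι → Ω => g i (v i)) ((‖M - -M‖₊ / 2) ^ 2)
      (Measure.pi fun _ => uniformOn Set.univ) := by
    refine .of_map (measurable_pi_apply i).aemeasurable (X := g i) ?_
    rw [(measurePreserving_eval _ i).map_eq]
    exact hasSubgaussianMGF_of_mem_Icc_of_integral_eq_zero .of_discrete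
      (ae_of_all _ fun ω => abs_le.1 (hg i ω)) ((integral_uniformOn_univ _).trans (hmean i))
  have hoeff := HasSubgaussianMGF.measure_sum_ge_le_of_iIndepFun
    (iIndepFun_pi (X := g) fun i => .of_discrete) (s := .univ) (fun i _ => hsub i) hε
  have hcard := uniformOn_apply_finset (s := Finset.univ)
    (t := ({v | ε ≤ ∑ i, g i (v i)} : Finset (ι → Ω)))
  rw [← hpi, measureReal_def] at hoeff
  simp only [Finset.coe_univ, Finset.coe_filter, Finset.mem_univ, true_and, Finset.univ_inter,
    Finset.card_univ] at hcard
  rw [hcard, ENNReal.toReal_div, ENNReal.toReal_natCast, ENNReal.toReal_natCast,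
    div_le_iff₀ (by exact_mod_cast Fintype.card_pos)] at hoeff
  have hvar : ((∑ _i : ι, (‖M - -M‖₊ / 2) ^ 2 : NNReal) : ℝ) = Fintype.card ι * M ^ 2 := by
    simp [← two_mul]
  rwa [hvar] at hoeff

theorem card_lt_abs_sum_apply_le {ι Ω : Type*} [Fintype ι] [DecidableEq ι] [Fintype Ω]
    [Nonempty Ω] {g : ι → Ω → ℝ} {M ε : ℝ} (hε : 0 ≤ ε) (hg : ∀ i ω, |g i ω| ≤ M)
    (hmean : ∀ i, 𝔼 ω, g i ω = 0) :
    (Finset.card {v : ι → Ω | ε < |(∑ i, g i (v i) : ℝ)|} : ℝ) ≤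
      2 * Real.exp (-ε ^ 2 / (2 * (Fintype.card ι * M ^ 2))) * Fintype.card (ι → Ω) := by
  classical
  have hpos := card_le_sum_apply_le hε hg hmean
  have hneg := card_le_sum_apply_le hε (g := fun i ω => -g i ω) (by simpa using hg)
    (by simpa using hmean)
  have hsubset : ({v | ε < |∑ i, g i (v i)|} : Finset (ι → Ω)) ⊆
      ({v | ε ≤ ∑ i, g i (v i)} : Finset (ι → Ω)) ∪
        ({v | ε ≤ ∑ i, -g i (v i)} : Finset (ι → Ω)) := by
    intro v hv
    simp only [Finset.mem_filter, Finset.mem_union, Finset.mem_univ, true_and,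
      Finset.sum_neg_distrib] at hv ⊢
    exact (lt_abs.1 hv).imp le_of_lt le_of_lt
  have hunion : (_ : ℝ) ≤ _ :=
    Nat.cast_le.2 ((Finset.card_le_card hsubset).trans (Finset.card_union_le _ _))
  push_cast at hunion
  linarith

theorem expect_mem_Icc {ι : Type*} {s : Finset ι} {g : ι → ℝ} (hg : ∀ i ∈ s, g i ∈ Set.Icc 0 1) :
    𝔼 i ∈ s, g i ∈ Set.Icc 0 1 := by
  refine ⟨Finset.expect_nonneg fun i hi => (hg i hi).1, ?_⟩
  rcases s.eq_empty_or_nonempty with rfl | hs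
  · simp
  · exact Finset.expect_le hs fun i hi => (hg i hi).2

theorem abs_expect_sub_expect_le {ι : Type*} {s t : Finset ι} (hst : s ⊆ t) {g : ι → ℝ}
    (hg : ∀ i ∈ t, g i ∈ Set.Icc 0 1) :
    |𝔼 i ∈ s, g i - 𝔼 i ∈ t, g i| ≤ 1 - s.card / t.card := by
  classical
  rcases t.eq_empty_or_nonempty with rfl | ht
  · simp [Finset.subset_empty.1 hst]
  have ht0 : (0 : ℝ) < t.card := by exact_mod_cast ht.card_pos
  have hcard : (t.card : ℝ) = (t \ s).card + s.card := by
    exact_mod_cast (Finset.card_sdiff_add_card_eq_card hst).symm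
  have hsum : (t.card : ℝ) * 𝔼 i ∈ t, g i =
      (t \ s).card * 𝔼 i ∈ t \ s, g i + s.card * 𝔼 i ∈ s, g i := by
    simp only [← nsmul_eq_mul, Finset.card_smul_expect, Finset.sum_sdiff hst]
  have hdiff : t.card * (𝔼 i ∈ s, g i - 𝔼 i ∈ t, g i) =
      (t \ s).card * (𝔼 i ∈ s, g i - 𝔼 i ∈ t \ s, g i) := by
    rw [mul_sub, hsum, hcard]; ring
  have hle : |𝔼 i ∈ s, g i - 𝔼 i ∈ t \ s, g i| ≤ 1 := by
    have h₁ := expect_mem_Icc fun i hi => hg i (hst hi)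
    have h₂ := expect_mem_Icc fun i hi => hg i (Finset.mem_sdiff.1 hi : i ∈ t ∧ i ∉ s).1
    exact abs_sub_le_of_nonneg_of_le h₁.1 h₁.2 h₂.1 h₂.2
  refine le_of_mul_le_mul_left ?_ ht0
  calc t.card * |𝔼 i ∈ s, g i - 𝔼 i ∈ t, g i|
      = (t \ s).card * |𝔼 i ∈ s, g i - 𝔼 i ∈ t \ s, g i| := by
        rw [← Nat.abs_cast t.card, ← abs_mul, hdiff, abs_mul, Nat.abs_cast]
    _ ≤ (t \ s).card := mul_le_of_le_one_right (Nat.cast_nonneg _) hle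
    _ = t.card * (1 - s.card / t.card) := by rw [hcard]; rw [hcard] at ht0; field_simp; ring

theorem expect_coe_sort {ι : Type*} (s : Finset ι) (f : ι → ℝ) :
    𝔼 i : s, f i = 𝔼 i ∈ s, f i := by
  rw [Fintype.expect_eq_sum_div_card, Finset.expect_eq_sum_div_card, Finset.sum_coe_sort,
    Fintype.card_coe]

theorem expect_pi_apply {ι Ω : Type*} [Fintype ι] [DecidableEq ι] [Fintype Ω] [Nonempty Ω]
    (f : Ω → ℝ) (i : ι) : 𝔼 v : ι → Ω, f (v i) = 𝔼 ω, f ω := by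
  have hsum := Fintype.sum_piFinset_apply f Finset.univ i
  simp only [Fintype.piFinset_univ, Finset.card_univ, nsmul_eq_mul, Nat.cast_pow] at hsum
  have hcard : (Fintype.card Ω : ℝ) ≠ 0 := by exact_mod_cast Fintype.card_ne_zero
  rw [Fintype.expect_eq_sum_div_card, Fintype.expect_eq_sum_div_card, hsum, Fintype.card_fun,
    ← Nat.sub_add_cancel (Fintype.card_pos_iff.2 ⟨i⟩ : 0 < Fintype.card ι), Nat.cast_pow, pow_succ]
  field_simp
  simp [mul_comm]

theorem sum_range_mul {M : Type*} [AddCommMonoid M] (q p : ℕ) (g : ℕ → M) :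
    ∑ i ∈ Finset.range (q * p), g i =
      ∑ s ∈ Finset.range q, ∑ j ∈ Finset.range p, g (s * p + j) := by
  induction q with
  | zero => simp
  | succ q ih => rw [Nat.succ_mul, Finset.sum_range_add, ih, Finset.sum_range_succ]

theorem expect_range_mul (q p : ℕ) (g : ℕ → ℝ) :
    𝔼 i ∈ Finset.range (q * p), g i =
      𝔼 s ∈ Finset.range q, 𝔼 j ∈ Finset.range p, g (s * p + j) := by
  simp only [Finset.expect_eq_sum_div_card, sum_range_mul, Finset.card_range, Nat.cast_mul,
    Finset.sum_div]
  exact Finset.sum_congr rfl fun s _ => Finset.sum_congr rfl fun j _ => by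
    rw [div_div, mul_comm (q : ℝ)]

theorem expect_range_mul_of_periodic {p q : ℕ} (hq : q ≠ 0) {F : ℕ → ℝ}
    (hF : Function.Periodic F p) :
    𝔼 i ∈ Finset.range (q * p), F i = 𝔼 j ∈ Finset.range p, F j := by
  have hshift (s j : ℕ) : F (s * p + j) = F j := by
    rw [add_comm]
    exact_mod_cast hF.nat_mul s j
  simp only [expect_range_mul, hshift]
  exact Finset.expect_const (Finset.nonempty_range_iff.2 hq) _

theorem sum_range_ite_lt_add_le (p r : ℕ) :
    ∑ i ∈ Finset.range p, (if p < i + r then (1 : ℝ) else 0) ≤ r := by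
  rw [Finset.sum_boole, Nat.cast_le]
  calc (Finset.card {i ∈ Finset.range p | p < i + r}) ≤ (Finset.Ico (p - r) p).card :=
        Finset.card_le_card fun i hi => by
          simp only [Finset.mem_filter, Finset.mem_range, Finset.mem_Ico] at hi ⊢
          omega
    _ ≤ r := by rw [Nat.card_Ico]; omega

/-! ### Words and blocks -/

section Words

variable {A : Type*}

/-- The sequence `x` begins with the word `w`. -/
def StartsWith (w : List A) (x : ℕ → A) : Prop := ∀ i (h : i < w.length), x i = w[i]

open Classical in
/-- The indicator of the sequences that begin with the word `w`. -/
noncomputable def wordInd (w : List A) (x : ℕ → A) : ℝ := if StartsWith w x then 1 else 0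

/-- The indicator of an occurrence of `w` at position `j` of the finite word `x 0, …, x (p - 1)`. -/
noncomputable def wordHits (w : List A) (p : ℕ) (x : ℕ → A) (j : ℕ) : ℝ :=
  if j + w.length ≤ p then wordInd w (shift j x) else 0

/-- The proportion of the words of length `p` in `B` that have an occurrence of `w` at position
`j`. Positions are read modulo `p`, which makes the proportion a `p`-periodic sequence. -/
noncomputable def wordFreq (B : Finset (ℕ → A)) (w : List A) (p j : ℕ) : ℝ :=
  𝔼 b ∈ B, wordHits w p b (j % p)

/-- The concatenation of `q` words of length `p`, extended by a default symbol. -/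
def concat [Inhabited A] (p : ℕ) {q : ℕ} (v : Fin q → ℕ → A) (i : ℕ) : A :=
  if h : i / p < q then v ⟨i / p, h⟩ (i % p) else default

theorem wordInd_mem_Icc (w : List A) (x : ℕ → A) : wordInd w x ∈ Set.Icc 0 1 := by
  unfold wordInd; split_ifs <;> norm_num

theorem wordHits_mem_Icc (w : List A) (p : ℕ) (x : ℕ → A) (j : ℕ) :
    wordHits w p x j ∈ Set.Icc 0 1 := by
  unfold wordHits
  split_ifs
  · exact wordInd_mem_Icc ..
  · norm_num

theorem wordFreq_mem_Icc (B : Finset (ℕ → A)) (w : List A) (p j : ℕ) :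
    wordFreq B w p j ∈ Set.Icc 0 1 :=
  expect_mem_Icc fun _ _ => wordHits_mem_Icc ..

theorem wordInd_congr {w : List A} {x x' : ℕ → A} (h : ∀ i < w.length, x i = x' i) :
    wordInd w x = wordInd w x' := by
  have : StartsWith w x ↔ StartsWith w x' :=
    forall₂_congr fun i hi => by rw [h i hi]
  classical
  exact if_congr this rfl rfl

theorem wordFreq_periodic (B : Finset (ℕ → A)) (w : List A) (p : ℕ) :
    Function.Periodic (wordFreq B w p) p := fun j => by
  simp only [wordFreq, Nat.add_mod_right]

theorem concat_mul_add [Inhabited A] {p q : ℕ} (v : Fin q → ℕ → A) (s : Fin q) {j : ℕ}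
    (hj : j < p) : concat p v (s * p + j) = v s j := by
  have hdiv : (s * p + j) / p = s := by
    rw [mul_comm, Nat.mul_add_div (by omega), Nat.div_eq_of_lt hj, add_zero]
  have hmod : (s * p + j) % p = j := by
    rw [mul_comm, Nat.mul_add_mod, Nat.mod_eq_of_lt hj]
  simp [concat, hdiv, hmod]

theorem concat_eq_default [Inhabited A] {p q : ℕ} (hp : 0 < p) (v : Fin q → ℕ → A) {i : ℕ}
    (hi : q * p ≤ i) : concat p v i = default :=
  dif_neg (not_lt.2 ((Nat.le_div_iff_mul_le hp).2 hi))

theorem wordHits_concat [Inhabited A] {w : List A} {p q : ℕ} (v : Fin q → ℕ → A) (s : Fin q)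
    {i : ℕ} (hi : i + w.length ≤ p) :
    wordHits w (q * p) (concat p v) (s * p + i) = wordHits w p (v s) i := by
  have hle : s * p + i + w.length ≤ q * p :=
    calc s * p + i + w.length ≤ (s + 1) * p := by rw [Nat.succ_mul]; omega
      _ ≤ q * p := Nat.mul_le_mul_right p s.2
  rw [wordHits, wordHits, if_pos hle, if_pos hi]
  refine wordInd_congr fun j hj => ?_
  rw [shift_apply, shift_apply, add_assoc, concat_mul_add v s (by omega)]

theorem wordHits_le_wordHits_concat [Inhabited A] (w : List A) {p q : ℕ} (v : Fin q → ℕ → A)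
    (s : Fin q) (i : ℕ) :
    wordHits w p (v s) i ≤ wordHits w (q * p) (concat p v) (s * p + i) := by
  by_cases hi : i + w.length ≤ p
  · rw [wordHits_concat v s hi]
  · rw [wordHits, if_neg hi]
    exact (wordHits_mem_Icc ..).1

end Words

/-- A word together with a bounded weight: the occurrences of the word are to be counted with this
weight along every orbit. -/
structure WordTest (A : Type*) where
  word : List A
  weight : ℕ → ℝ
  abs_weight_le_one : ∀ j, |weight j| ≤ 1

namespace WordTest

variable {A : Type*} (t : WordTest A) (B : Finset (ℕ → A))

/-- The weighted number of occurrences of the test word in the word `b` of length `p` placed at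
position `i`, minus its mean over `b ∈ B`. -/
noncomputable def excess (p i : ℕ) (b : ℕ → A) : ℝ :=
  ∑ j ∈ Finset.range p, (wordHits t.word p b j - wordFreq B t.word p j) * t.weight (i + j)

theorem abs_excess_le (p i : ℕ) (b : ℕ → A) : |t.excess B p i b| ≤ p := by
  have hterm (j : ℕ) :
      |(wordHits t.word p b j - wordFreq B t.word p j) * t.weight (i + j)| ≤ 1 := by
    obtain ⟨h₀, h₁⟩ := wordHits_mem_Icc t.word p b j
    obtain ⟨h₂, h₃⟩ := wordFreq_mem_Icc B t.word p j
    rw [abs_mul]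
    exact mul_le_one₀ (abs_sub_le_of_nonneg_of_le h₀ h₁ h₂ h₃) (abs_nonneg _)
      (t.abs_weight_le_one _)
  calc |t.excess B p i b| ≤ ∑ _j ∈ Finset.range p, (1 : ℝ) :=
        (Finset.abs_sum_le_sum_abs _ _).trans (Finset.sum_le_sum fun j _ => hterm j)
    _ = p := by simp

variable {B}

theorem expect_excess (hB : B.Nonempty) (p i : ℕ) : 𝔼 b ∈ B, t.excess B p i b = 0 := by
  simp only [excess]
  rw [Finset.expect_sum_comm]
  refine Finset.sum_eq_zero fun j hj => ?_
  rw [← Finset.expect_mul, Finset.expect_sub_distrib, Finset.expect_const hB, wordFreq,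
    Nat.mod_eq_of_lt (Finset.mem_range.1 hj), sub_self, zero_mul]

theorem card_lt_abs_sum_excess_le (hB : B.Nonempty) (p q i : ℕ) {ε : ℝ} (hε : 0 ≤ ε) :
    (Finset.card {v : Fin q → B | ε < |∑ s : Fin q, t.excess B p (i + s * p) (v s)|} : ℝ) ≤
      2 * Real.exp (-ε ^ 2 / (2 * (q * p ^ 2))) * Fintype.card (Fin q → B) := by
  have : Nonempty B := hB.to_subtype
  simpa using card_lt_abs_sum_apply_le (g := fun (s : Fin q) (b : B) =>
    t.excess B p (i + s * p) b) hε (fun s b => t.abs_excess_le B p _ b) fun s => by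
      rw [expect_coe_sort B fun b => t.excess B p (i + s * p) b, t.expect_excess hB]

end WordTest

/-- The data of a hierarchy of blocks: the blocks of level `0` are all the words of length `base`,
and a concatenation of blocks of level `k` is admitted as a block of level `k + 1` if it passes the
tests `0, …, k`. The bound on `base` lets `exp (p ^ 2 / 2)` dominate the `8 * p ^ 52 * card A ^ p`
of the union bound over all tests and starting positions. -/
structure BlockScheme (A : Type*) [Fintype A] where
  base : ℕ
  le_base : 2 * (53 + Fintype.card A) ≤ base
  test : ℕ → WordTest A

namespace BlockScheme

variable {A : Type*} [Fintype A] (S : BlockScheme A)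

/-- The length of the blocks of level `k`. -/
def period (k : ℕ) : ℕ := S.base ^ 5 ^ k

theorem period_succ (k : ℕ) : S.period (k + 1) = S.period k ^ 4 * S.period k := by
  rw [period, period, pow_succ 5, pow_mul, pow_succ]

theorem base_le_period (k : ℕ) : S.base ≤ S.period k :=
  Nat.le_self_pow (by positivity) S.base

theorem le_period (k : ℕ) : 106 ≤ S.period k := by
  linarith [S.le_base, S.base_le_period k]

theorem period_pos (k : ℕ) : 0 < S.period k := by
  linarith [S.le_period k]

theorem two_mul_period_le (k : ℕ) : 2 * S.period k ≤ S.period (k + 1) := by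
  rw [period_succ]
  gcongr
  linarith [S.le_period k, Nat.le_self_pow (by norm_num : 4 ≠ 0) (S.period k)]

theorem period_strictMono : StrictMono S.period :=
  strictMono_nat_of_lt_succ fun k => by
    linarith [S.two_mul_period_le k, S.period_pos k]

theorem lt_period (k : ℕ) : k < S.period k := by
  induction k with
  | zero => exact S.period_pos 0
  | succ k ih => linarith [S.two_mul_period_le k]

theorem period_dvd {k m : ℕ} (h : k ≤ m) : S.period k ∣ S.period m :=
  pow_dvd_pow _ (Nat.pow_le_pow_right (by norm_num) h)

theorem exists_period_sq_le_lt {k n : ℕ} (hn : S.period (k + 1) ^ 2 ≤ n) :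
    ∃ m ≥ k, S.period (m + 1) ^ 2 ≤ n ∧ n < S.period (m + 2) ^ 2 := by
  classical
  have hex : ∃ d, n < S.period (k + d + 2) ^ 2 :=
    ⟨n, ((S.lt_period n).trans_le (S.period_strictMono.monotone (by omega))).trans_le
      (Nat.le_self_pow two_ne_zero _)⟩
  refine ⟨k + Nat.find hex, Nat.le_add_right _ _, ?_, Nat.find_spec hex⟩
  rcases hd : Nat.find hex with - | d
  · exact hn
  · exact not_lt.1 (Nat.find_min hex (hd ▸ Nat.lt_succ_self d))

theorem expect_range_period_of_periodic {F : ℕ → ℝ} {k m : ℕ} (hkm : k ≤ m)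
    (hF : Function.Periodic F (S.period k)) :
    𝔼 j ∈ Finset.range (S.period m), F j = 𝔼 j ∈ Finset.range (S.period k), F j := by
  obtain ⟨q, hq⟩ := S.period_dvd hkm
  have hq0 : q ≠ 0 := by rintro rfl; simp [(S.period_pos m).ne'] at hq
  rw [hq, mul_comm, expect_range_mul_of_periodic hq0 hF]

/-- An upper bound for the proportion of the concatenations of blocks of level `k` that fail a
test. -/
noncomputable def defect (k : ℕ) : ℝ :=
  1 / (4 * S.period k * (Fintype.card A : ℝ) ^ S.period k)

open Classical in
/-- The concatenations of `period k ^ 4` words from `B`, a set of words of length `period k`, that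
pass the tests `0, …, k` from every starting position up to `period (k + 2) ^ 2`. -/
noncomputable def balanced (k : ℕ) (B : Finset (ℕ → A)) : Finset (Fin (S.period k ^ 4) → B) :=
  {v | ∀ l ≤ k, ∀ i < S.period (k + 2) ^ 2,
    |∑ s : Fin _, (S.test l).excess B (S.period k) (i + s * S.period k) (v s)| ≤ S.period k ^ 4}

section Defect

variable [Nonempty A]

theorem one_le_card : (1 : ℝ) ≤ Fintype.card A := by
  exact_mod_cast (Fintype.card_pos : 0 < Fintype.card A)

theorem defect_pos (k : ℕ) : 0 < S.defect k := by
  have := S.period_pos k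
  have := one_le_card (A := A)
  unfold defect
  positivity

theorem defect_le (k : ℕ) : S.defect k ≤ 1 / (4 * S.period k) := by
  have hp : (0 : ℝ) < S.period k := by exact_mod_cast S.period_pos k
  refine one_div_le_one_div_of_le (by positivity) ?_
  exact le_mul_of_one_le_right (by positivity) (one_le_pow₀ one_le_card)

theorem defect_le_half (k : ℕ) : S.defect k ≤ 1 / 2 := by
  have hp : (1 : ℝ) ≤ S.period k := by exact_mod_cast S.period_pos k
  exact (S.defect_le k).trans (one_div_le_one_div_of_le (by norm_num) (by linarith))

theorem two_mul_defect_succ_le (k : ℕ) : 2 * S.defect (k + 1) ≤ S.defect k := by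
  have hp : (0 : ℝ) < S.period k := by exact_mod_cast S.period_pos k
  have hp2 : (2 : ℝ) * S.period k ≤ S.period (k + 1) := by exact_mod_cast S.two_mul_period_le k
  have hpow : (Fintype.card A : ℝ) ^ S.period k ≤ (Fintype.card A : ℝ) ^ S.period (k + 1) :=
    pow_le_pow_right₀ one_le_card (S.period_strictMono.monotone (Nat.le_succ k))
  have : (0 : ℝ) < Fintype.card A := one_pos.trans_le one_le_card
  calc 2 * S.defect (k + 1)
      = 1 / (2 * S.period (k + 1) * (Fintype.card A : ℝ) ^ S.period (k + 1)) := by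
        have : (0 : ℝ) < S.period (k + 1) := by linarith
        unfold defect; field_simp; norm_num
    _ ≤ 1 / (2 * (2 * S.period k) * (Fintype.card A : ℝ) ^ S.period k) := by gcongr
    _ = S.defect k := by unfold defect; congr 1; ring

theorem union_bound_le_defect (k : ℕ) :
    ((k : ℝ) + 1) * S.period (k + 2) ^ 2 * (2 * Real.exp (-(S.period k : ℝ) ^ 2 / 2)) ≤
      S.defect k := by
  set p := S.period k with hp
  have hpA : 2 * ((53 : ℝ) + Fintype.card A) ≤ p := by
    exact_mod_cast S.le_base.trans (S.base_le_period k)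
  have hA := one_le_card (A := A)
  have hp0 : (0 : ℝ) < p := by linarith
  have hk : (k : ℝ) + 1 ≤ p := by exact_mod_cast S.lt_period k
  have hperiod : (S.period (k + 2) : ℝ) = p ^ 25 := by
    rw [period_succ, period_succ, ← hp]; push_cast; ring
  have hp_exp : (p : ℝ) ≤ Real.exp p := by linarith [Real.add_one_le_exp (p : ℝ)]
  have hA_exp : (Fintype.card A : ℝ) ≤ Real.exp (Fintype.card A) := by
    linarith [Real.add_one_le_exp (Fintype.card A : ℝ)]
  have hgrowth : (8 : ℝ) * p ^ 52 * (Fintype.card A : ℝ) ^ p ≤ Real.exp ((p : ℝ) ^ 2 / 2) :=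
    calc (8 : ℝ) * p ^ 52 * (Fintype.card A : ℝ) ^ p
        ≤ p * p ^ 52 * (Fintype.card A : ℝ) ^ p := by gcongr; linarith
      _ = (p : ℝ) ^ 53 * (Fintype.card A : ℝ) ^ p := by ring
      _ ≤ Real.exp p ^ 53 * Real.exp (Fintype.card A) ^ p := by gcongr
      _ = Real.exp (p * (53 + Fintype.card A)) := by
          rw [← Real.exp_nat_mul, ← Real.exp_nat_mul, ← Real.exp_add]; congr 1; push_cast; ring
      _ ≤ Real.exp ((p : ℝ) ^ 2 / 2) := Real.exp_le_exp.2 (by nlinarith)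
  rw [defect, le_div_iff₀ (by positivity), hperiod, neg_div, Real.exp_neg]
  calc ((k : ℝ) + 1) * (p ^ 25) ^ 2 * (2 * (Real.exp ((p : ℝ) ^ 2 / 2))⁻¹) *
        (4 * p * (Fintype.card A : ℝ) ^ p)
      ≤ p * (p ^ 25) ^ 2 * (2 * (Real.exp ((p : ℝ) ^ 2 / 2))⁻¹) *
        (4 * p * (Fintype.card A : ℝ) ^ p) := by gcongr
    _ = 8 * p ^ 52 * (Fintype.card A : ℝ) ^ p / Real.exp ((p : ℝ) ^ 2 / 2) := by ring
    _ ≤ 1 := div_le_one_of_le₀ hgrowth (Real.exp_pos _).le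

end Defect

section Balanced

variable {B : Finset (ℕ → A)}

variable {S} in
theorem abs_sum_excess_le_of_mem_balanced {k l i : ℕ} {v : Fin (S.period k ^ 4) → B}
    (hv : v ∈ S.balanced k B) (hl : l ≤ k) (hi : i < S.period (k + 2) ^ 2) :
    |∑ s : Fin _, (S.test l).excess B (S.period k) (i + s * S.period k) (v s)| ≤
      S.period k ^ 4 := by
  classical
  exact (Finset.mem_filter.1 hv).2 l hl i hi

theorem card_failing_le (hB : B.Nonempty) (k l i : ℕ) :
    (Finset.card {v : Fin (S.period k ^ 4) → B | (S.period k : ℝ) ^ 4 <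
      |∑ s : Fin _, (S.test l).excess B (S.period k) (i + s * S.period k) (v s)|} : ℝ) ≤
      2 * Real.exp (-(S.period k : ℝ) ^ 2 / 2) * (B.card : ℝ) ^ (S.period k ^ 4) := by
  have hp : (0 : ℝ) < S.period k := by exact_mod_cast S.period_pos k
  refine ((S.test l).card_lt_abs_sum_excess_le hB _ _ i (by positivity)).trans_eq ?_
  simp only [Fintype.card_pi_const, Fintype.card_coe, Nat.cast_pow]
  congr 3
  field_simp

variable [Nonempty A]

theorem card_univ_sdiff_balanced_le [DecidableEq (ℕ → A)] (hB : B.Nonempty) (k : ℕ) :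
    ((Finset.univ \ S.balanced k B).card : ℝ) ≤
      S.defect k * (B.card : ℝ) ^ (S.period k ^ 4) := by
  classical
  let failing (e : ℕ × ℕ) : Finset (Fin (S.period k ^ 4) → B) :=
    {v | (S.period k : ℝ) ^ 4 <
      |∑ s : Fin _, (S.test e.1).excess B (S.period k) (e.2 + s * S.period k) (v s)|}
  have hcover : Finset.univ \ S.balanced k B ⊆
      (Finset.range (k + 1) ×ˢ Finset.range (S.period (k + 2) ^ 2)).biUnion failing := by
    intro v hv
    simp only [balanced, Finset.mem_sdiff, Finset.mem_filter, Finset.mem_univ, true_and] at hv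
    push Not at hv
    obtain ⟨l, hl, i, hi, hlt⟩ := hv
    simp only [Finset.mem_biUnion, Finset.mem_product, Finset.mem_range]
    exact ⟨(l, i), ⟨Nat.lt_succ_of_le hl, hi⟩, by simpa [failing] using hlt⟩
  calc ((Finset.univ \ S.balanced k B).card : ℝ)
      ≤ ∑ e ∈ Finset.range (k + 1) ×ˢ Finset.range (S.period (k + 2) ^ 2),
          ((failing e).card : ℝ) := by
        exact_mod_cast (Finset.card_le_card hcover).trans Finset.card_biUnion_le
    _ ≤ (k + 1) * S.period (k + 2) ^ 2 * (2 * Real.exp (-(S.period k : ℝ) ^ 2 / 2)) *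
          (B.card : ℝ) ^ (S.period k ^ 4) := by
        refine (Finset.sum_le_sum fun e _ => S.card_failing_le hB k e.1 e.2).trans_eq ?_
        simp only [Finset.sum_const, Finset.card_product, Finset.card_range, nsmul_eq_mul]
        push_cast
        ring
    _ ≤ S.defect k * (B.card : ℝ) ^ (S.period k ^ 4) := by
        gcongr
        exact S.union_bound_le_defect k

theorem le_card_balanced (hB : B.Nonempty) (k : ℕ) :
    (1 - S.defect k) * (B.card : ℝ) ^ (S.period k ^ 4) ≤ (S.balanced k B).card := by
  classical
  have hsum : ((Finset.univ \ S.balanced k B).card : ℝ) + (S.balanced k B).card =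
      (B.card : ℝ) ^ (S.period k ^ 4) := by
    rw [← Nat.cast_add, Finset.card_sdiff_add_card_eq_card (Finset.subset_univ _)]
    simp
  linarith [S.card_univ_sdiff_balanced_le hB k]

end Balanced

variable [Inhabited A]

open Classical in
/-- The blocks of level `k`, as sequences extended by a default symbol. -/
noncomputable def blocks : ℕ → Finset (ℕ → A)
  | 0 => Finset.univ.image fun u : Fin S.base → A => concat 1 fun s _ => u s
  | k + 1 => (S.balanced k (blocks k)).image fun v => concat (S.period k) fun s => (v s).1

variable {S}

theorem mem_blocks_succ {k : ℕ} {b : ℕ → A} : b ∈ S.blocks (k + 1) ↔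
    ∃ v ∈ S.balanced k (S.blocks k), concat (S.period k) (fun s => (v s).1) = b := by
  simp [blocks]

theorem eq_default_of_mem_blocks {k : ℕ} {b : ℕ → A} (hb : b ∈ S.blocks k) {i : ℕ}
    (hi : S.period k ≤ i) : b i = default := by
  cases k with
  | zero =>
    simp only [blocks, Finset.mem_image, Finset.mem_univ, true_and] at hb
    obtain ⟨u, rfl⟩ := hb
    exact concat_eq_default one_pos _ (by simpa [period] using hi)
  | succ k =>
    obtain ⟨v, -, rfl⟩ := mem_blocks_succ.1 hb
    exact concat_eq_default (S.period_pos k) _ (by rwa [← period_succ])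

theorem blocks_ext {k : ℕ} {b b' : ℕ → A} (hb : b ∈ S.blocks k) (hb' : b' ∈ S.blocks k)
    (h : ∀ j < S.period k, b j = b' j) : b = b' := by
  funext j
  rcases lt_or_ge j (S.period k) with hj | hj
  · exact h j hj
  · rw [eq_default_of_mem_blocks hb hj, eq_default_of_mem_blocks hb' hj]

variable (S)

theorem concat_blocks_injective (k q : ℕ) : Function.Injective
    fun v : Fin q → S.blocks k => concat (S.period k) fun s => (v s).1 := by
  intro v v' h
  funext s
  refine Subtype.ext (blocks_ext (v s).2 (v' s).2 fun j hj => ?_)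
  simpa only [concat_mul_add _ s hj] using congrFun h (s * S.period k + j)

theorem card_blocks_zero : (S.blocks 0).card = Fintype.card A ^ S.base := by
  classical
  rw [blocks, Finset.card_image_of_injective]
  · simp
  · intro u u' h
    funext s
    simpa only [concat_mul_add _ s one_pos] using congrFun h (s * 1 + 0)

theorem card_blocks_succ (k : ℕ) :
    (S.blocks (k + 1)).card = (S.balanced k (S.blocks k)).card := by
  classical
  exact Finset.card_image_of_injective _ (S.concat_blocks_injective k _)

theorem card_blocks_le (k : ℕ) : (S.blocks k).card ≤ Fintype.card A ^ S.period k := by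
  induction k with
  | zero => simp [card_blocks_zero, period]
  | succ k ih =>
    calc (S.blocks (k + 1)).card ≤ Fintype.card (Fin (S.period k ^ 4) → S.blocks k) := by
          rw [card_blocks_succ]; exact Finset.card_le_univ _
      _ = (S.blocks k).card ^ S.period k ^ 4 := by simp
      _ ≤ (Fintype.card A ^ S.period k) ^ S.period k ^ 4 := by gcongr
      _ = Fintype.card A ^ S.period (k + 1) := by rw [period_succ, mul_comm, pow_mul]

theorem blocks_nonempty (k : ℕ) : (S.blocks k).Nonempty := by
  induction k with
  | zero =>
    rw [← Finset.card_pos, card_blocks_zero]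
    exact Nat.pow_pos Fintype.card_pos
  | succ k ih =>
    have : (0 : ℝ) < (S.blocks k).card := by exact_mod_cast ih.card_pos
    have hpos : 0 < (1 - S.defect k) * ((S.blocks k).card : ℝ) ^ (S.period k ^ 4) :=
      mul_pos (by linarith [S.defect_le_half k]) (by positivity)
    rw [← Finset.card_pos, card_blocks_succ]
    exact_mod_cast hpos.trans_le (S.le_card_balanced ih k)

theorem le_card_blocks_succ (k : ℕ) :
    (1 - S.defect k) * ((S.blocks k).card : ℝ) ^ (S.period k ^ 4) ≤ (S.blocks (k + 1)).card := by
  rw [card_blocks_succ]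
  exact S.le_card_balanced (S.blocks_nonempty k) k

end BlockScheme

/-! ### Word frequencies in blocks -/

namespace BlockScheme

variable {A : Type*} [Fintype A] [Inhabited A] (S : BlockScheme A)

/-- The proportion of the blocks of level `k` in which `w` occurs at position `j`, continued
periodically in `j`. -/
noncomputable def freq (w : List A) (k j : ℕ) : ℝ := wordFreq (S.blocks k) w (S.period k) j

/-- The average over all positions of the frequency of `w` in the blocks of level `k`. -/
noncomputable def meanFreq (w : List A) (k : ℕ) : ℝ :=
  𝔼 j ∈ Finset.range (S.period k), S.freq w k j

theorem freq_mem_Icc (w : List A) (k j : ℕ) : S.freq w k j ∈ Set.Icc 0 1 :=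
  wordFreq_mem_Icc ..

theorem freq_periodic (w : List A) (k : ℕ) : Function.Periodic (S.freq w k) (S.period k) :=
  wordFreq_periodic (S.blocks k) w (S.period k)

theorem freq_of_lt (w : List A) {k j : ℕ} (hj : j < S.period k) :
    S.freq w k j = 𝔼 b ∈ S.blocks k, wordHits w (S.period k) b j := by
  rw [freq, wordFreq, Nat.mod_eq_of_lt hj]

theorem freq_succ_of_lt (w : List A) {k s i : ℕ} (hs : s < S.period k ^ 4) (hi : i < S.period k) :
    S.freq w (k + 1) (s * S.period k + i) = 𝔼 v ∈ S.balanced k (S.blocks k),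
      wordHits w (S.period k ^ 4 * S.period k) (concat (S.period k) fun s => (v s).1)
        (s * S.period k + i) := by
  classical
  have hlt : s * S.period k + i < S.period (k + 1) :=
    calc s * S.period k + i < (s + 1) * S.period k := by rw [Nat.succ_mul]; omega
      _ ≤ S.period (k + 1) := by rw [period_succ]; exact Nat.mul_le_mul_right _ hs
  rw [freq_of_lt _ _ hlt, blocks, Finset.expect_image (S.concat_blocks_injective k _).injOn,
    period_succ]

theorem abs_expect_balanced_sub_freq_le (w : List A) {k i : ℕ} (s : Fin (S.period k ^ 4))
    (hi : i < S.period k) :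
    |𝔼 v ∈ S.balanced k (S.blocks k), wordHits w (S.period k) (v s) i - S.freq w k i| ≤
      S.defect k := by
  have hne := S.blocks_nonempty k
  have : Nonempty (S.blocks k) := hne.to_subtype
  have hfreq : S.freq w k i = 𝔼 v : Fin (S.period k ^ 4) → S.blocks k,
      wordHits w (S.period k) (v s) i := by
    rw [expect_pi_apply (fun b : S.blocks k => wordHits w (S.period k) b i) s,
      expect_coe_sort (S.blocks k) fun b => wordHits w (S.period k) b i, S.freq_of_lt w hi]
  have : (0 : ℝ) < (S.blocks k).card := by exact_mod_cast hne.card_pos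
  calc _ ≤ 1 - ((S.balanced k (S.blocks k)).card : ℝ) / (S.blocks k).card ^ (S.period k ^ 4) := by
        rw [hfreq]
        simpa using abs_expect_sub_expect_le (Finset.subset_univ (S.balanced k (S.blocks k)))
          fun v _ => wordHits_mem_Icc w (S.period k) (v s).1 i
    _ ≤ S.defect k := by
        rw [sub_le_comm, le_div_iff₀ (by positivity)]
        exact S.le_card_balanced hne k

theorem freq_sub_defect_le (w : List A) {k s i : ℕ} (hs : s < S.period k ^ 4)
    (hi : i < S.period k) :
    S.freq w k i - S.defect k ≤ S.freq w (k + 1) (s * S.period k + i) := by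
  have hle := (abs_le.1 (S.abs_expect_balanced_sub_freq_le w ⟨s, hs⟩ hi)).1
  rw [S.freq_succ_of_lt w hs hi]
  refine le_trans (by linarith) (Finset.expect_le_expect fun v _ =>
    wordHits_le_wordHits_concat w (fun s => (v s).1) ⟨s, hs⟩ i)

theorem abs_freq_succ_sub_freq_le (w : List A) {k s i : ℕ} (hs : s < S.period k ^ 4)
    (hi : i < S.period k) (hw : i + w.length ≤ S.period k) :
    |S.freq w (k + 1) (s * S.period k + i) - S.freq w k i| ≤ S.defect k := by
  rw [S.freq_succ_of_lt w hs hi]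
  simp only [wordHits_concat _ (⟨s, hs⟩ : Fin _) hw]
  exact S.abs_expect_balanced_sub_freq_le w ⟨s, hs⟩ hi

theorem expect_abs_freq_succ_sub_freq_le (w : List A) (k : ℕ) :
    𝔼 j ∈ Finset.range (S.period (k + 1)), |S.freq w (k + 1) j - S.freq w k j| ≤
      (w.length + 1) / S.period k := by
  have hp : (0 : ℝ) < S.period k := by exact_mod_cast S.period_pos k
  rw [period_succ, expect_range_mul]
  refine Finset.expect_le (by simp [S.period_pos k |>.ne']) fun s hs => ?_
  rw [Finset.mem_range] at hs
  have hterm (i : ℕ) (hi : i < S.period k) :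
      |S.freq w (k + 1) (s * S.period k + i) - S.freq w k (s * S.period k + i)| ≤
        S.defect k + if S.period k < i + w.length then 1 else 0 := by
    have hper : S.freq w k (s * S.period k + i) = S.freq w k i := by
      rw [add_comm]; exact_mod_cast (S.freq_periodic w k).nat_mul s i
    rw [hper]
    split_ifs with hw
    · obtain ⟨h₀, h₁⟩ := S.freq_mem_Icc w (k + 1) (s * S.period k + i)
      obtain ⟨h₂, h₃⟩ := S.freq_mem_Icc w k i
      linarith [abs_sub_le_of_nonneg_of_le h₀ h₁ h₂ h₃, S.defect_pos k]
    · rw [add_zero]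
      exact S.abs_freq_succ_sub_freq_le w hs hi (not_lt.1 hw)
  have hsum := (Finset.sum_le_sum fun i hi => hterm i (Finset.mem_range.1 hi)).trans_eq
    Finset.sum_add_distrib
  have hdefect : S.period k * S.defect k ≤ 1 := by
    have := S.defect_le k
    rw [le_div_iff₀ (by positivity)] at this
    nlinarith [S.defect_pos k]
  rw [Finset.expect_eq_sum_div_card, Finset.card_range]
  gcongr
  rw [Finset.sum_const, Finset.card_range, nsmul_eq_mul] at hsum
  linarith [sum_range_ite_lt_add_le (S.period k) w.length]

theorem freq_periodic_of_le (w : List A) {k m : ℕ} (hkm : k ≤ m) :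
    Function.Periodic (S.freq w k) (S.period m) := by
  obtain ⟨q, hq⟩ := S.period_dvd hkm
  rw [hq, mul_comm]
  exact_mod_cast (S.freq_periodic w k).nat_mul q

theorem expect_abs_freq_sub_freq_le (w : List A) {k m : ℕ} (hkm : k ≤ m) :
    𝔼 j ∈ Finset.range (S.period m), |S.freq w m j - S.freq w k j| ≤
      (w.length + 1) * (2 / S.period k - 2 / S.period m) := by
  induction m, hkm using Nat.le_induction with
  | base => simp
  | succ m hkm ih =>
    have hp : (0 : ℝ) < S.period m := by exact_mod_cast S.period_pos m
    have hp2 : (2 : ℝ) * S.period m ≤ S.period (m + 1) := by exact_mod_cast S.two_mul_period_le m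
    have hper : Function.Periodic (fun j => |S.freq w m j - S.freq w k j|) (S.period m) :=
      fun j => by simp only [S.freq_periodic w m j, S.freq_periodic_of_le w hkm j]
    calc _ ≤ 𝔼 j ∈ Finset.range (S.period (m + 1)),
          (|S.freq w (m + 1) j - S.freq w m j| + |S.freq w m j - S.freq w k j|) :=
          Finset.expect_le_expect fun j _ => abs_sub_le _ _ _
      _ ≤ (w.length + 1) / S.period m + (w.length + 1) * (2 / S.period k - 2 / S.period m) := by
          rw [Finset.expect_add_distrib, S.expect_range_period_of_periodic (Nat.le_succ m) hper]
          gcongr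
          exact S.expect_abs_freq_succ_sub_freq_le w m
      _ = (w.length + 1) * (2 / S.period k - 1 / S.period m) := by ring
      _ ≤ (w.length + 1) * (2 / S.period k - 2 / S.period (m + 1)) := by
          have : (2 : ℝ) / S.period (m + 1) ≤ 1 / S.period m := by
            rw [div_le_div_iff₀ (by linarith) hp]
            linarith
          gcongr

theorem meanFreq_sub_defect_le (w : List A) (k : ℕ) :
    S.meanFreq w k - S.defect k ≤ S.meanFreq w (k + 1) := by
  have hne : (Finset.range (S.period k)).Nonempty := by simp [(S.period_pos k).ne']
  rw [meanFreq, meanFreq, period_succ, expect_range_mul]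
  refine Finset.le_expect (by simp [(S.period_pos k).ne']) fun s hs => ?_
  rw [← Finset.expect_const hne (S.defect k), ← Finset.expect_sub_distrib]
  exact Finset.expect_le_expect fun i hi =>
    S.freq_sub_defect_le w (Finset.mem_range.1 hs) (Finset.mem_range.1 hi)

theorem meanFreq_sub_le (w : List A) {k m : ℕ} (hkm : k ≤ m) :
    S.meanFreq w k - 2 * S.defect k + 2 * S.defect m ≤ S.meanFreq w m := by
  induction m, hkm using Nat.le_induction with
  | base => linarith
  | succ m _ ih =>
    linarith [S.meanFreq_sub_defect_le w m, S.two_mul_defect_succ_le m]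

end BlockScheme

/-! ### Points of a scheme -/

namespace BlockScheme

variable {A : Type*} [Fintype A] [Inhabited A] (S : BlockScheme A)

/-- The points all of whose prefixes occur in blocks. -/
def points : Set (ℕ → A) :=
  {x | ∀ n, ∃ m, ∃ b ∈ S.blocks m, ∃ t, t + n ≤ S.period m ∧ Set.EqOn x (shift t b) (Set.Iio n)}

theorem shift_mem_points {x : ℕ → A} (hx : x ∈ S.points) (g : ℕ) : shift g x ∈ S.points := by
  intro n
  obtain ⟨m, b, hb, t, ht, h⟩ := hx (g + n)
  refine ⟨m, b, hb, t + g, by omega, fun i hi => ?_⟩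
  rw [shift_apply, h (by simpa using hi : g + i ∈ Set.Iio (g + n)), shift_apply, shift_apply,
    add_assoc]

theorem exists_mem_blocks_eqOn_of_dvd {k m : ℕ} (hkm : k ≤ m) {b : ℕ → A} (hb : b ∈ S.blocks m)
    {t : ℕ} (ht : S.period k ∣ t) (htm : t < S.period m) :
    ∃ b' ∈ S.blocks k, Set.EqOn (shift t b) b' (Set.Iio (S.period k)) := by
  induction m, hkm using Nat.le_induction generalizing b t with
  | base => exact ⟨b, hb, by simp [Nat.eq_zero_of_dvd_of_lt ht htm, Set.eqOn_refl]⟩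
  | succ m hkm ih =>
    obtain ⟨v, -, rfl⟩ := mem_blocks_succ.1 hb
    have hmod : t % S.period m < S.period m := Nat.mod_lt t (S.period_pos m)
    have hdvd : S.period k ∣ t % S.period m := (Nat.dvd_mod_iff (S.period_dvd hkm)).2 ht
    have hs : t / S.period m < S.period m ^ 4 := by
      rwa [Nat.div_lt_iff_lt_mul (S.period_pos m), ← period_succ]
    obtain ⟨b', hb', h⟩ := ih (v ⟨_, hs⟩).2 hdvd hmod
    refine ⟨b', hb', fun j hj => ?_⟩
    have hlt : t % S.period m + j < S.period m := by
      have hle : t % S.period m + S.period k ≤ S.period m :=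
        Nat.ModEq.add_le_of_lt (((Nat.modEq_zero_iff_dvd.2 hdvd)).trans
          (Nat.modEq_zero_iff_dvd.2 (S.period_dvd hkm)).symm) hmod
      have hj : j < S.period k := hj
      omega
    rw [← h hj, shift_apply, shift_apply, ← concat_mul_add (fun s => (v s).1) ⟨_, hs⟩ hlt,
      ← add_assoc, Nat.div_add_mod']

theorem exists_alignment {x : ℕ → A} (hx : x ∈ S.points) (k n : ℕ) :
    ∃ a ≤ S.period k, ∀ s, a + (s + 1) * S.period k ≤ n →
      ∃ b ∈ S.blocks k, Set.EqOn (shift (a + s * S.period k) x) b (Set.Iio (S.period k)) := by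
  obtain ⟨m, b, hb, t, ht, h⟩ := hx (max n (S.period k))
  have hkm : k ≤ m := S.period_strictMono.le_iff_le.1 (by omega)
  have hmod : t % S.period k < S.period k := Nat.mod_lt t (S.period_pos k)
  refine ⟨S.period k - t % S.period k, Nat.sub_le _ _, fun s hs => ?_⟩
  set a := S.period k - t % S.period k
  have hdvd : S.period k ∣ t + a := by
    refine ⟨t / S.period k + 1, ?_⟩
    rw [Nat.mul_succ, ← Nat.add_sub_assoc hmod.le]
    have := Nat.div_add_mod t (S.period k)
    omega
  rw [Nat.succ_mul] at hs
  obtain ⟨b', hb', h'⟩ := S.exists_mem_blocks_eqOn_of_dvd hkm hb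
    (hdvd.add (dvd_mul_left _ s)) (by have := S.period_pos k; omega)
  refine ⟨b', hb', fun j hj => ?_⟩
  have hlt : a + s * S.period k + j ∈ Set.Iio (max n (S.period k)) := by
    have hj : j < S.period k := hj
    exact lt_max_of_lt_left (b := n) (by omega)
  rw [← h' hj, shift_apply, h hlt, shift_apply, shift_apply]
  simp only [add_assoc]

end BlockScheme

/-! ### Discrepancy along an orbit -/

theorem sum_abs_wordInd_sub_wordHits_le {A : Type*} (w : List A) {p : ℕ} {x v : ℕ → A}
    (h : Set.EqOn x v (Set.Iio p)) :
    ∑ j ∈ Finset.range p, |wordInd w (shift j x) - wordHits w p v j| ≤ w.length := by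
  refine le_trans (Finset.sum_le_sum fun j _ => ?_) (sum_range_ite_lt_add_le p w.length)
  split_ifs with hw
  · obtain ⟨h₀, h₁⟩ := wordInd_mem_Icc w (shift j x)
    obtain ⟨h₂, h₃⟩ := wordHits_mem_Icc w p v j
    exact abs_sub_le_of_nonneg_of_le h₀ h₁ h₂ h₃
  · rw [wordHits, if_pos (not_lt.1 hw), wordInd_congr (x' := shift j v), sub_self, abs_zero]
    exact fun i hi => h (show j + i < p by omega)

theorem abs_sum_range_le {g : ℕ → ℝ} {C : ℝ} (hg : ∀ j, |g j| ≤ C) (n : ℕ) :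
    |∑ j ∈ Finset.range n, g j| ≤ n * C :=
  (Finset.abs_sum_le_sum_abs _ _).trans
    ((Finset.sum_le_card_nsmul _ _ C fun j _ => hg j).trans_eq (by simp))

theorem abs_sum_range_le_of_windows {g : ℕ → ℝ} {a q n : ℕ} {δ : ℝ} (hq : 0 < q)
    (hg : ∀ j, |g j| ≤ 1) (ha : a ≤ q) (hδ : 0 ≤ δ)
    (hwin : ∀ s, a + (s + 1) * q ≤ n → |∑ j ∈ Finset.range q, g (a + s * q + j)| ≤ q * δ) :
    |∑ j ∈ Finset.range n, g j| ≤ 2 * q + n * δ := by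
  have hpart (u r : ℕ) : |∑ j ∈ Finset.range r, g (u + j)| ≤ r := by
    simpa using abs_sum_range_le (fun j => hg (u + j)) r
  have haq : (a : ℝ) ≤ q := by exact_mod_cast ha
  rcases lt_or_ge n a with hna | hna
  · have hn : (n : ℝ) ≤ a := by exact_mod_cast hna.le
    have := hpart 0 n
    simp only [zero_add] at this
    linarith [show 0 ≤ n * δ by positivity]
  obtain ⟨N, r, hr, rfl⟩ : ∃ N r, r < q ∧ n = a + (N * q + r) :=
    ⟨(n - a) / q, (n - a) % q, Nat.mod_lt _ hq, by rw [Nat.div_add_mod']; omega⟩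
  have hmid : |∑ j ∈ Finset.range (N * q), g (a + j)| ≤ N * (q * δ) := by
    rw [sum_range_mul]
    refine (Finset.abs_sum_le_sum_abs _ _).trans
      ((Finset.sum_le_card_nsmul _ _ (q * δ) fun s hs => ?_).trans_eq (by simp))
    have hsN : (s + 1) * q ≤ N * q := Nat.mul_le_mul_right q (Finset.mem_range.1 hs)
    simpa only [add_assoc] using hwin s (by omega)
  have hrq : (r : ℝ) ≤ q := by exact_mod_cast hr.le
  have hsplit : ∑ j ∈ Finset.range (a + (N * q + r)), g j = ∑ j ∈ Finset.range a, g (0 + j) +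
      (∑ j ∈ Finset.range (N * q), g (a + j) + ∑ j ∈ Finset.range r, g (a + N * q + j)) := by
    simp only [Finset.sum_range_add, zero_add, add_assoc]
  calc |∑ j ∈ Finset.range (a + (N * q + r)), g j| ≤ a + (N * (q * δ) + r) := by
        rw [hsplit]
        exact (abs_add_le _ _).trans (add_le_add (hpart 0 a)
          ((abs_add_le _ _).trans (add_le_add hmid (hpart _ r))))
    _ ≤ 2 * q + (a + (N * q + r)) * δ := by
        linarith [show 0 ≤ a * δ by positivity, show 0 ≤ r * δ by positivity]
    _ = 2 * q + (a + (N * q + r) : ℕ) * δ := by push_cast; rfl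

theorem eqOn_shift_of_eqOn_concat {A : Type*} [Inhabited A] {p q : ℕ} {v : Fin q → ℕ → A}
    {x : ℕ → A} (hx : Set.EqOn x (concat p v) (Set.Iio (q * p))) (s : Fin q) :
    Set.EqOn (shift (s * p) x) (v s) (Set.Iio p) := fun j hj => by
  have hlt : s * p + j < q * p :=
    calc s * p + j < (s + 1) * p := by rw [Nat.succ_mul]; exact Nat.add_lt_add_left hj _
      _ ≤ q * p := Nat.mul_le_mul_right p s.2
  rw [shift_apply, hx hlt, concat_mul_add v s hj]

namespace BlockScheme

variable {A : Type*} [Fintype A] [Inhabited A] (S : BlockScheme A)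

/-- The deviation of the indicator of `w` along the orbit of `x` from its frequency in the blocks of
level `k`, when `x` is regarded as cut into blocks at the positions congruent to `-a`. -/
noncomputable def discrepancy (w : List A) (k a : ℕ) (x : ℕ → A) (j : ℕ) : ℝ :=
  wordInd w (shift j x) - S.freq w k (j + a)

theorem abs_discrepancy_le (w : List A) (k a : ℕ) (x : ℕ → A) (j : ℕ) :
    |S.discrepancy w k a x j| ≤ 1 := by
  obtain ⟨h₀, h₁⟩ := wordInd_mem_Icc w (shift j x)
  obtain ⟨h₂, h₃⟩ := S.freq_mem_Icc w k (j + a)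
  exact abs_sub_le_of_nonneg_of_le h₀ h₁ h₂ h₃

theorem discrepancy_add {k a t : ℕ} (h : S.period k ∣ t + a) (w : List A) (x : ℕ → A) (j : ℕ) :
    S.discrepancy w k a x (t + j) = S.discrepancy w k 0 (shift t x) j := by
  obtain ⟨c, hc⟩ := h
  have hfreq : S.freq w k (t + j + a) = S.freq w k (j + 0) := by
    rw [add_right_comm, hc, add_comm, add_zero, mul_comm]
    exact_mod_cast (S.freq_periodic w k).nat_mul c j
  rw [discrepancy, discrepancy, hfreq, shift_add t j]

theorem abs_sum_discrepancy_sub_excess_le (t : WordTest A) {k m : ℕ} (hkm : k ≤ m)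
    {v x : ℕ → A} (hx : Set.EqOn x v (Set.Iio (S.period m))) (i : ℕ) :
    |∑ j ∈ Finset.range (S.period m), S.discrepancy t.word k 0 x j * t.weight (i + j) -
      t.excess (S.blocks m) (S.period m) i v| ≤
      S.period m * (2 * (t.word.length + 1) / S.period k) := by
  set w := t.word
  set p := S.period m
  have hp0 : (0 : ℝ) < p := by exact_mod_cast S.period_pos m
  have hfreq : ∑ j ∈ Finset.range p, |S.freq w m j - S.freq w k j| ≤
      p * ((w.length + 1) * (2 / S.period k - 2 / p)) := by
    have := S.expect_abs_freq_sub_freq_le w hkm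
    rwa [Finset.expect_eq_sum_div_card, Finset.card_range, div_le_iff₀' hp0] at this
  calc _ = |∑ j ∈ Finset.range p, ((wordInd w (shift j x) - wordHits w p v j) +
          (S.freq w m j - S.freq w k j)) * t.weight (i + j)| := by
        rw [WordTest.excess, ← Finset.sum_sub_distrib]
        congr 1
        refine Finset.sum_congr rfl fun j _ => ?_
        simp only [discrepancy, freq, add_zero]
        ring
    _ ≤ ∑ j ∈ Finset.range p, (|wordInd w (shift j x) - wordHits w p v j| +
          |S.freq w m j - S.freq w k j|) := by
        refine (Finset.abs_sum_le_sum_abs _ _).trans (Finset.sum_le_sum fun j _ => ?_)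
        rw [abs_mul]
        exact (mul_le_of_le_one_right (abs_nonneg _) (t.abs_weight_le_one _)).trans
          (abs_add_le _ _)
    _ ≤ w.length + p * ((w.length + 1) * (2 / S.period k - 2 / p)) := by
        rw [Finset.sum_add_distrib]
        exact add_le_add (sum_abs_wordInd_sub_wordHits_le w hx) hfreq
    _ = p * (2 * (w.length + 1) / S.period k) - (w.length + 2) := by field_simp; ring
    _ ≤ p * (2 * (w.length + 1) / S.period k) := by linarith [w.length.cast_nonneg (α := ℝ)]

theorem abs_sum_discrepancy_block_le {l k m : ℕ} (hlk : l ≤ k) (hkm : k ≤ m) {b x : ℕ → A}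
    (hb : b ∈ S.blocks (m + 1)) (hx : Set.EqOn x b (Set.Iio (S.period (m + 1)))) {i : ℕ}
    (hi : i < S.period (m + 2) ^ 2) :
    |∑ j ∈ Finset.range (S.period (m + 1)),
      S.discrepancy (S.test l).word k 0 x j * (S.test l).weight (i + j)| ≤
      S.period (m + 1) * (3 * ((S.test l).word.length + 1) / S.period k) := by
  obtain ⟨v, hv, rfl⟩ := mem_blocks_succ.1 hb
  have hbal := abs_sum_excess_le_of_mem_balanced hv (hlk.trans hkm) hi
  rw [period_succ] at hx
  have hagree := eqOn_shift_of_eqOn_concat hx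
  set t := S.test l
  set D : Fin (S.period m ^ 4) → ℝ := fun s => ∑ j ∈ Finset.range (S.period m),
    S.discrepancy t.word k 0 (shift (s * S.period m) x) j * t.weight (i + s * S.period m + j)
  have hk0 : (0 : ℝ) < S.period k := by exact_mod_cast S.period_pos k
  have hkp : (S.period k : ℝ) ≤ S.period m := by exact_mod_cast S.period_strictMono.monotone hkm
  have hsplit : ∑ j ∈ Finset.range (S.period (m + 1)),
      S.discrepancy t.word k 0 x j * t.weight (i + j) = ∑ s, D s := by
    rw [period_succ, sum_range_mul, Finset.sum_range]
    refine Finset.sum_congr rfl fun s _ => Finset.sum_congr rfl fun j _ => ?_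
    rw [S.discrepancy_add (by simpa using (S.period_dvd hkm).mul_left s), add_assoc]
  calc _ = |∑ s : Fin _, t.excess (S.blocks m) (S.period m) (i + s * S.period m) (v s) +
          ∑ s, (D s - t.excess (S.blocks m) (S.period m) (i + s * S.period m) (v s))| := by
        rw [hsplit, Finset.sum_sub_distrib, add_sub_cancel]
    _ ≤ S.period m ^ 4 +
          S.period m ^ 4 * (S.period m * (2 * (t.word.length + 1) / S.period k)) := by
        refine (abs_add_le _ _).trans (add_le_add hbal ((Finset.abs_sum_le_sum_abs _ _).trans
          ((Finset.sum_le_card_nsmul _ _ _ fun s _ =>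
            S.abs_sum_discrepancy_sub_excess_le t hkm (hagree s) _).trans_eq (by simp))))
    _ ≤ S.period m ^ 4 * (S.period m / S.period k) +
          S.period m ^ 4 * (S.period m * (2 * (t.word.length + 1) / S.period k)) := by
        gcongr
        exact le_mul_of_one_le_right (by positivity) ((one_le_div hk0).2 hkp)
    _ = S.period m ^ 4 * S.period m * ((2 * t.word.length + 3) / S.period k) := by ring
    _ ≤ S.period (m + 1) * (3 * (t.word.length + 1) / S.period k) := by
        rw [period_succ]
        push_cast
        gcongr
        linarith [t.word.length.cast_nonneg (α := ℝ)]

theorem exists_abs_sum_discrepancy_le {l k : ℕ} (hlk : l ≤ k) {x : ℕ → A} (hx : x ∈ S.points)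
    {n : ℕ} (hn : S.period (k + 1) ^ 2 ≤ n) :
    ∃ a, |∑ j ∈ Finset.range n, S.discrepancy (S.test l).word k a x j * (S.test l).weight j| ≤
      n * (5 * ((S.test l).word.length + 1) / S.period k) := by
  obtain ⟨m, hkm, hmn, hnm⟩ := S.exists_period_sq_le_lt hn
  obtain ⟨a, haq, hal⟩ := S.exists_alignment hx (m + 1) n
  set t := S.test l
  set q := S.period (m + 1)
  have hq : 0 < q := S.period_pos (m + 1)
  refine ⟨q - a, (abs_sum_range_le_of_windows hq (fun j => ?_) haq
    (δ := 3 * (t.word.length + 1) / S.period k) (by positivity) fun s hs => ?_).trans ?_⟩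
  · rw [abs_mul]
    exact mul_le_one₀ (S.abs_discrepancy_le ..) (abs_nonneg _) (t.abs_weight_le_one j)
  · obtain ⟨b, hb, hxb⟩ := hal s hs
    have hdvd : S.period k ∣ a + s * q + (q - a) := by
      rw [show a + s * q + (q - a) = (s + 1) * q by rw [Nat.succ_mul]; omega]
      exact (S.period_dvd (by omega)).mul_left _
    simp only [S.discrepancy_add hdvd]
    exact S.abs_sum_discrepancy_block_le hlk hkm hb hxb (by rw [Nat.succ_mul] at hs; omega)
  · have hk0 : (0 : ℝ) < S.period k := by exact_mod_cast S.period_pos k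
    have hqn : (q : ℝ) ≤ n / S.period k := by
      rw [le_div_iff₀ hk0]
      have hkq : (S.period k : ℝ) ≤ q := by
        exact_mod_cast S.period_strictMono.monotone (show k ≤ m + 1 by omega)
      calc (q : ℝ) * S.period k ≤ q ^ 2 := by rw [sq]; gcongr
        _ ≤ n := by exact_mod_cast hmn
    calc 2 * q + n * (3 * ((t.word.length : ℝ) + 1) / S.period k)
        ≤ 2 * (n / S.period k) + n * (3 * (t.word.length + 1) / S.period k) := by gcongr
      _ = n * ((3 * t.word.length + 5) / S.period k) := by ring
      _ ≤ n * (5 * (t.word.length + 1) / S.period k) := by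
          gcongr
          linarith [t.word.length.cast_nonneg (α := ℝ)]

theorem four_mul_defect_le_meanFreq {w : List A} {m j : ℕ} {b : ℕ → A} (hb : b ∈ S.blocks m)
    (hj : j < S.period m) (hw : wordHits w (S.period m) b j = 1) :
    4 * S.defect m ≤ S.meanFreq w m := by
  have hp : (0 : ℝ) < S.period m := by exact_mod_cast S.period_pos m
  have hcard : ((S.blocks m).card : ℝ) ≤ (Fintype.card A : ℝ) ^ S.period m := by
    exact_mod_cast S.card_blocks_le m
  have hfreq : 1 / (Fintype.card A : ℝ) ^ S.period m ≤ S.freq w m j := by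
    rw [S.freq_of_lt w hj, Finset.expect_eq_sum_div_card]
    have hpos : (0 : ℝ) < (S.blocks m).card := by exact_mod_cast Finset.card_pos.2 ⟨b, hb⟩
    exact div_le_div₀ (Finset.sum_nonneg fun b _ => (wordHits_mem_Icc ..).1)
      (hw.ge.trans (Finset.single_le_sum (f := fun b => wordHits w (S.period m) b j)
        (fun b _ => (wordHits_mem_Icc ..).1) hb)) hpos hcard
  calc 4 * S.defect m = 1 / (Fintype.card A : ℝ) ^ S.period m / S.period m := by
        rw [defect]; field_simp
    _ ≤ S.freq w m j / S.period m := by gcongr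
    _ ≤ S.meanFreq w m := by
        rw [meanFreq, Finset.expect_eq_sum_div_card, Finset.card_range]
        gcongr
        exact Finset.single_le_sum (fun i _ => (S.freq_mem_Icc w m i).1) (Finset.mem_range.2 hj)

theorem exists_startsWith_block {l k : ℕ} (hlk : l ≤ k) (hone : ∀ j, (S.test l).weight j = 1)
    (hfreq : 1 < S.period k * S.meanFreq (S.test l).word k) {b : ℕ → A}
    (hb : b ∈ S.blocks (k + 1)) :
    ∃ j, j + (S.test l).word.length ≤ S.period (k + 1) ∧
      StartsWith (S.test l).word (shift j b) := by
  obtain ⟨v, hv, rfl⟩ := mem_blocks_succ.1 hb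
  have hbal := abs_sum_excess_le_of_mem_balanced hv hlk (pow_pos (S.period_pos (k + 2)) 2)
  set w := (S.test l).word
  have hexcess (i : ℕ) (b : ℕ → A) : (S.test l).excess (S.blocks k) (S.period k) i b =
      ∑ j ∈ Finset.range (S.period k), wordHits w (S.period k) b j -
        S.period k * S.meanFreq w k := by
    have hp : (S.period k : ℝ) ≠ 0 := by exact_mod_cast (S.period_pos k).ne'
    simp only [WordTest.excess, hone, mul_one, Finset.sum_sub_distrib, meanFreq, freq,
      Finset.expect_eq_sum_div_card, Finset.card_range, mul_div_cancel₀ _ hp]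
    rfl
  have hpos : 0 < ∑ s : Fin (S.period k ^ 4), ∑ j ∈ Finset.range (S.period k),
      wordHits w (S.period k) (v s) j := by
    have hlow := (abs_le.1 hbal).1
    simp only [hexcess, Finset.sum_sub_distrib, Finset.sum_const, Finset.card_univ,
      Fintype.card_fin, nsmul_eq_mul, Nat.cast_pow] at hlow
    have hp4 : (0 : ℝ) < (S.period k : ℝ) ^ 4 := by
      have := S.period_pos k
      positivity
    linarith [mul_lt_mul_of_pos_left hfreq hp4]
  obtain ⟨s, -, hs⟩ := Finset.exists_ne_zero_of_sum_ne_zero hpos.ne'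
  obtain ⟨j, -, hsj⟩ := Finset.exists_ne_zero_of_sum_ne_zero hs
  have hjw : j + w.length ≤ S.period k := by
    by_contra h
    exact hsj (if_neg h)
  rw [← wordHits_concat (fun s => (v s).1) s hjw, ← period_succ] at hsj
  unfold wordHits wordInd at hsj
  exact ⟨s * S.period k + j, by simpa using hsj⟩

theorem exists_startsWith_of_mem_points {l m j : ℕ} (hone : ∀ i, (S.test l).weight i = 1)
    {b : ℕ → A} (hb : b ∈ S.blocks m) (hj : j < S.period m)
    (hjw : wordHits (S.test l).word (S.period m) b j = 1) {x : ℕ → A} (hx : x ∈ S.points) :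
    ∃ i, StartsWith (S.test l).word (shift i x) := by
  have hd := S.defect_pos m
  obtain ⟨n, hn⟩ := exists_nat_gt (1 / (2 * S.defect m))
  set k := max n (max l m)
  have hfreq : 1 < S.period k * S.meanFreq (S.test l).word k :=
    calc 1 < n * (2 * S.defect m) := (div_lt_iff₀ (by positivity)).1 hn
      _ ≤ S.period k * S.meanFreq (S.test l).word k := by
        have hnk : (n : ℝ) ≤ S.period k := by
          exact_mod_cast (le_max_left n _).trans (S.lt_period k).le
        have hmk := S.meanFreq_sub_le (S.test l).word (show m ≤ k by omega)
        have hm := S.four_mul_defect_le_meanFreq hb hj hjw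
        gcongr
        linarith [S.defect_pos k]
  obtain ⟨a, ha, hal⟩ := S.exists_alignment hx (k + 1) (2 * S.period (k + 1))
  obtain ⟨b', hb', hxb⟩ := hal 0 (by omega)
  obtain ⟨i, hi, hs⟩ := S.exists_startsWith_block (by omega) hone hfreq hb'
  refine ⟨a + i, fun r hr => ?_⟩
  rw [← hs r hr, shift_apply, shift_apply, ← hxb (show i + r < S.period (k + 1) by omega),
    shift_apply]
  simp only [zero_mul, add_zero, add_assoc]

end BlockScheme

/-! ### Weighted averages on subshifts -/

theorem tendstoUniformly_zero_of_dense_span {E ι κ : Type*} [SeminormedAddCommGroup E]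
    [NormedSpace ℝ E] {s : Set E} (hs : Dense (Submodule.span ℝ s : Set E)) {l : Filter κ}
    {Λ : κ → ι → E →ₗ[ℝ] ℝ} {K : ℝ} (hΛ : ∀ n i f, |Λ n i f| ≤ K * ‖f‖)
    (h : ∀ g ∈ s, TendstoUniformly (fun n i => Λ n i g) 0 l) (f : E) :
    TendstoUniformly (fun n i => Λ n i f) 0 l := by
  have hspan (g : E) (hg : g ∈ Submodule.span ℝ s) :
      TendstoUniformly (fun n i => Λ n i g) 0 l := by
    induction hg using Submodule.span_induction with
    | mem g hg => exact h g hg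
    | zero => simpa [Metric.tendstoUniformly_iff] using fun ε hε => .of_forall fun _ _ => hε
    | add g g' _ _ hg hg' =>
      simp only [map_add]
      exact add_zero (0 : ι → ℝ) ▸ hg.add hg'
    | smul c g _ hg =>
      simp only [map_smul]
      have hc : (c • ·) ∘ (0 : ι → ℝ) = 0 := funext fun _ => smul_zero c
      exact hc ▸ (uniformContinuous_const_smul c).comp_tendstoUniformly hg
  rw [Metric.tendstoUniformly_iff]
  intro ε hε
  obtain ⟨g, hg, hfg⟩ := hs.exists_dist_lt f (show 0 < ε / (2 * (|K| + 1)) by positivity)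
  filter_upwards [Metric.tendstoUniformly_iff.1 (hspan g hg) (ε / 2) (half_pos hε)] with n hn i
  have hgn := hn i
  simp only [Pi.zero_apply, dist_zero_left, Real.norm_eq_abs] at hgn ⊢
  have hdiff : |Λ n i (f - g)| ≤ ε / 2 :=
    calc |Λ n i (f - g)| ≤ K * ‖f - g‖ := hΛ n i _
      _ ≤ (|K| + 1) * (ε / (2 * (|K| + 1))) := by
        rw [← dist_eq_norm]
        gcongr
        linarith [le_abs_self K]
      _ = ε / 2 := by field_simp
  calc |Λ n i f| = |Λ n i (f - g) + Λ n i g| := by rw [← map_add, sub_add_cancel]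
    _ ≤ |Λ n i (f - g)| + |Λ n i g| := abs_add_le _ _
    _ < ε := by linarith

/-- The average of a function over the first `n` points of the orbit of `x` with weights `z`, as a
functional of the function. -/
noncomputable def weightedAverage {X : Type*} [TopologicalSpace X] (T : X → X) (z : ℕ → ℝ) (n : ℕ)
    (x : X) : C(X, ℝ) →ₗ[ℝ] ℝ where
  toFun f := (n : ℝ)⁻¹ * ∑ j ∈ Finset.range n, f (T^[j] x) * z j
  map_add' f g := by simp [add_mul, Finset.sum_add_distrib, mul_add]
  map_smul' c f := by simp [mul_assoc, mul_left_comm, ← Finset.mul_sum]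

theorem weightedAverage_apply {X : Type*} [TopologicalSpace X] (T : X → X) (z : ℕ → ℝ) (n : ℕ)
    (x : X) (f : C(X, ℝ)) :
    weightedAverage T z n x f = (n : ℝ)⁻¹ * ∑ j ∈ Finset.range n, f (T^[j] x) * z j :=
  rfl

theorem abs_weightedAverage_le {X : Type*} [TopologicalSpace X] [CompactSpace X] (T : X → X)
    {z : ℕ → ℝ} (hz : ∀ j, |z j| ≤ 1) (n : ℕ) (x : X) (f : C(X, ℝ)) :
    |weightedAverage T z n x f| ≤ ‖f‖ := by
  have hterm (j : ℕ) : |f (T^[j] x) * z j| ≤ ‖f‖ := by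
    rw [abs_mul]
    exact (mul_le_of_le_one_right (abs_nonneg _) (hz j)).trans (f.norm_coe_le_norm _)
  rw [weightedAverage_apply, abs_mul, abs_inv, Nat.abs_cast]
  exact inv_mul_le_of_le_mul₀ n.cast_nonneg (norm_nonneg f) (abs_sum_range_le hterm n)

section Subshift

variable {A : Type*}

theorem subshiftMap_iterate_val [TopologicalSpace A] (S : Subshift A ℕ) (i : ℕ) (x : S.carrier) :
    ((subshiftMap S)^[i] x).1 = shift i x.1 := by
  induction i with
  | zero => simp
  | succ i ih =>
    rw [Function.iterate_succ_apply', shift_add, ← ih]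
    rfl

theorem continuous_subshiftMap [TopologicalSpace A] (S : Subshift A ℕ) :
    Continuous (subshiftMap S) :=
  ((continuous_shift 1).comp continuous_subtype_val).subtype_mk _

theorem continuous_wordInd [TopologicalSpace A] [DiscreteTopology A] (w : List A) :
    Continuous (wordInd w) := by
  refine IsLocallyConstant.continuous ((IsLocallyConstant.iff_eventually_eq _).2 fun x => ?_)
  filter_upwards [(isOpen_cylinder (Finset.range w.length) x).mem_nhds fun i _ => rfl] with x' hx'
  exact wordInd_congr fun i hi => hx' i (Finset.mem_range.2 hi)

/-- The indicator of the sequences that begin with `w`, as a continuous function on a subshift. -/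
noncomputable def wordIndMap [TopologicalSpace A] [DiscreteTopology A] (S : Subshift A ℕ)
    (w : List A) : C(S.carrier, ℝ) where
  toFun x := wordInd w x
  continuous_toFun := (continuous_wordInd w).comp continuous_subtype_val

theorem weightedAverage_wordIndMap [TopologicalSpace A] [DiscreteTopology A] (S : Subshift A ℕ)
    (w : List A) (z : ℕ → ℝ) (n : ℕ) (x : S.carrier) :
    weightedAverage (subshiftMap S) z n x (wordIndMap S w) =
      (n : ℝ)⁻¹ * ∑ j ∈ Finset.range n, wordInd w (shift j x.1) * z j := by
  simp [weightedAverage_apply, wordIndMap, subshiftMap_iterate_val]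

theorem wordInd_ofFn [DecidableEq A] (x : ℕ → A) {r : ℕ} (u : Fin r → A) :
    wordInd (List.ofFn u) x = if (fun i : Fin r => x i) = u then 1 else 0 := by
  classical
  refine if_congr ⟨fun h => funext fun i => ?_, ?_⟩ rfl rfl
  · simpa using h i (by simp)
  · rintro rfl i hi
    simp

variable [UniformSpace A] [DiscreteUniformity A]

open Uniformity in
theorem exists_forall_eqOn_mem_of_mem_uniformity {C : Set (ℕ → A)} {U : Set (C × C)}
    (hU : U ∈ 𝓤 C) : ∃ r, ∀ x x' : C, Set.EqOn x.1 x'.1 (Set.Iio r) → (x, x') ∈ U := by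
  have hle : (⨅ r : ℕ, 𝓟 {q : C × C | Set.EqOn q.1.1 q.2.1 (Set.Iio r)}) ≤ 𝓤 C := by
    rw [uniformity_subtype, Pi.uniformity, comap_iInf]
    refine le_iInf fun i => (iInf_le _ (i + 1)).trans ?_
    rw [DiscreteUniformity.eq_principal_setRelId A, comap_principal, comap_principal,
      principal_mono]
    exact fun q hq => hq (Nat.lt_succ_self i)
  have hdir : Directed (· ≥ ·) fun r : ℕ => 𝓟 {q : C × C | Set.EqOn q.1.1 q.2.1 (Set.Iio r)} :=
    Antitone.directed_ge fun r r' hr =>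
      principal_mono.2 fun q hq => hq.mono (Set.Iio_subset_Iio hr)
  obtain ⟨r, hr⟩ := (mem_iInf_of_directed hdir _).1 (hle hU)
  exact ⟨r, fun x x' h => hr h⟩

variable [Finite A]

instance compactSpace_carrier (S : Subshift A ℕ) : CompactSpace S.carrier :=
  isCompact_iff_compactSpace.1 S.isClosed.isCompact

theorem dense_span_wordIndMap (S : Subshift A ℕ) :
    Dense (Submodule.span ℝ (Set.range (wordIndMap S)) : Set C(S.carrier, ℝ)) := by
  classical
  have := Fintype.ofFinite A
  refine Metric.dense_iff.2 fun f δ hδ => ?_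
  have hunif := CompactSpace.uniformContinuous_of_continuous f.continuous
  obtain ⟨r, hr⟩ := exists_forall_eqOn_mem_of_mem_uniformity
    (hunif (Metric.dist_mem_uniformity (half_pos hδ)))
  have hvalue (u : Fin r → A) : ∃ c, ∀ x : S.carrier, (fun i : Fin r => x.1 i) = u →
      dist c (f x) < δ / 2 := by
    by_cases hu : ∃ x : S.carrier, (fun i : Fin r => x.1 i) = u
    · obtain ⟨x, rfl⟩ := hu
      exact ⟨f x, fun x' h => hr x x' fun i hi => (congrFun h ⟨i, hi⟩).symm⟩
    · exact ⟨0, fun x h => absurd ⟨x, h⟩ hu⟩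
  choose c hc using hvalue
  set g : C(S.carrier, ℝ) := ∑ u : Fin r → A, c u • wordIndMap S (List.ofFn u)
  have hg (x : S.carrier) : g x = c fun i : Fin r => x.1 i := by
    simp [g, wordIndMap, wordInd_ofFn]
  refine ⟨g, ?_, Submodule.sum_mem _ fun u _ => Submodule.smul_mem _ _
    (Submodule.subset_span ⟨_, rfl⟩)⟩
  refine Metric.mem_ball.2 (((ContinuousMap.dist_le (half_pos hδ).le).2 fun x => ?_).trans_lt
    (half_lt_self hδ))
  rw [hg]
  exact (hc _ x rfl).le

theorem tendstoUniformly_weightedAverage {S : Subshift A ℕ} {z : ℕ → ℝ} (hz : ∀ j, |z j| ≤ 1)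
    (h : ∀ w, TendstoUniformly (fun (n : ℕ) (x : S.carrier) =>
      (n : ℝ)⁻¹ * ∑ j ∈ Finset.range n, wordInd w (shift j x.1) * z j) 0 atTop)
    (f : C(S.carrier, ℝ)) :
    TendstoUniformly (fun n x => weightedAverage (subshiftMap S) z n x f) 0 atTop := by
  refine tendstoUniformly_zero_of_dense_span (K := 1) (dense_span_wordIndMap S)
    (fun n x g => (abs_weightedAverage_le _ hz n x g).trans_eq (one_mul _).symm)
    (Set.forall_mem_range.2 fun w => ?_) f
  simp only [weightedAverage_wordIndMap]
  exact h w

theorem tendstoUniformly_weightedAverage_sub {S : Subshift A ℕ} {z : ℕ → ℝ} (hz : ∀ j, |z j| ≤ 1)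
    (h : ∀ w, TendstoUniformly (fun (n : ℕ) (q : S.carrier × S.carrier) =>
      (n : ℝ)⁻¹ * ∑ j ∈ Finset.range n, wordInd w (shift j q.1.1) * z j -
        (n : ℝ)⁻¹ * ∑ j ∈ Finset.range n, wordInd w (shift j q.2.1) * z j) 0 atTop)
    (f : C(S.carrier, ℝ)) :
    TendstoUniformly (fun n (q : S.carrier × S.carrier) =>
      weightedAverage (subshiftMap S) z n q.1 f - weightedAverage (subshiftMap S) z n q.2 f)
      0 atTop := by
  have hle (n : ℕ) (q : S.carrier × S.carrier) (g : C(S.carrier, ℝ)) :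
      |(weightedAverage (subshiftMap S) z n q.1 - weightedAverage (subshiftMap S) z n q.2) g| ≤
        2 * ‖g‖ := by
    rw [LinearMap.sub_apply, two_mul]
    exact (abs_sub _ _).trans
      (add_le_add (abs_weightedAverage_le _ hz n q.1 g) (abs_weightedAverage_le _ hz n q.2 g))
  refine tendstoUniformly_zero_of_dense_span (dense_span_wordIndMap S) hle
    (Set.forall_mem_range.2 fun w => ?_) f
  simp only [LinearMap.sub_apply, weightedAverage_wordIndMap]
  exact h w

end Subshift

/-! ### Unique ergodicity -/

section UniqueErgodicity

variable {X : Type*} [TopologicalSpace X] [MeasurableSpace X] {T : X → X}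

/-- The uniform distribution on the first `n + 1` points of the orbit of `x`. -/
noncomputable def empiricalMeasure (T : X → X) (n : ℕ) (x : X) : Measure X :=
  (ProbabilityTheory.uniformOn (Set.univ : Set (Fin (n + 1)))).map fun j : Fin (n + 1) => T^[j] x

instance isProbabilityMeasure_empiricalMeasure (n : ℕ) (x : X) :
    IsProbabilityMeasure (empiricalMeasure T n x) :=
  have := ProbabilityTheory.isProbabilityMeasure_uniformOn
    (Set.finite_univ (α := Fin (n + 1))) Set.univ_nonempty
  Measure.isProbabilityMeasure_map (measurable_of_finite _).aemeasurable

variable [BorelSpace X]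

theorem integral_empiricalMeasure (f : C(X, ℝ)) (n : ℕ) (x : X) :
    ∫ x', f x' ∂empiricalMeasure T n x = birkhoffAverage ℝ T f (n + 1) x := by
  rw [empiricalMeasure, integral_map (measurable_of_finite _).aemeasurable
    f.continuous.aestronglyMeasurable, integral_uniformOn_univ, Fintype.expect_eq_sum_div_card,
    birkhoffAverage, birkhoffSum, Finset.sum_range, Fintype.card_fin, smul_eq_mul, inv_mul_eq_div]

theorem integral_comp_iterate {μ : Measure X} (hμ : MeasurePreserving T μ μ) (f : C(X, ℝ))
    (j : ℕ) : ∫ x, f (T^[j] x) ∂μ = ∫ x, f x ∂μ := by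
  have h := hμ.iterate j
  rw [← integral_map h.aemeasurable f.continuous.aestronglyMeasurable, h.map_eq]

variable [CompactSpace X]

theorem tendsto_birkhoffAverage_integral (hT : Continuous T) {μ : Measure X}
    [IsProbabilityMeasure μ] (hμ : MeasurePreserving T μ μ) {f : C(X, ℝ)} {x₀ : X}
    (h : TendstoUniformly (fun n x => birkhoffAverage ℝ T f n x - birkhoffAverage ℝ T f n x₀) 0
      atTop) :
    Tendsto (fun n => birkhoffAverage ℝ T f n x₀) atTop (𝓝 (∫ x, f x ∂μ)) := by
  have hint (j : ℕ) : Integrable (fun x => f (T^[j] x)) μ :=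
    (f.continuous.comp (hT.iterate j)).integrable_of_hasCompactSupport (.of_compactSpace _)
  have havg (n : ℕ) : Integrable (birkhoffAverage ℝ T f n) μ :=
    (integrable_finsetSum _ fun j _ => hint j).smul (n : ℝ)⁻¹
  have hmean {n : ℕ} (hn : n ≠ 0) :
      ∫ x, birkhoffAverage ℝ T f n x ∂μ = ∫ x, f x ∂μ := by
    simp only [birkhoffAverage, integral_smul, birkhoffSum]
    rw [integral_finsetSum _ fun j _ => hint j]
    simp [integral_comp_iterate hμ, hn]
  rw [Metric.tendstoUniformly_iff] at h
  refine Metric.tendsto_nhds.2 fun ε hε => ?_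
  filter_upwards [h (ε / 2) (half_pos hε), eventually_ne_atTop 0] with n hn hn0
  have hdiff : ∫ x, f x ∂μ - birkhoffAverage ℝ T f n x₀ =
      ∫ x, (birkhoffAverage ℝ T f n x - birkhoffAverage ℝ T f n x₀) ∂μ := by
    rw [integral_sub (havg n) (integrable_const _), hmean hn0]
    simp
  rw [dist_comm, dist_eq_norm, hdiff]
  calc ‖_‖ ≤ ε / 2 * μ.real Set.univ :=
        norm_integral_le_of_norm_le_const (.of_forall fun x => by
          simpa [Real.dist_eq, abs_sub_comm] using (hn x).le)
    _ < ε := by simpa using hε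

variable [T2Space X] [HasOuterApproxClosed X]

theorem exists_isProbabilityMeasure_measurePreserving [Nonempty X] (hT : Continuous T) :
    ∃ μ : Measure X, IsProbabilityMeasure μ ∧ MeasurePreserving T μ μ := by
  obtain ⟨x₀⟩ := ‹Nonempty X›
  let ν (n : ℕ) : ProbabilityMeasure X := ⟨empiricalMeasure T n x₀, inferInstance⟩
  obtain ⟨μ, -, hμ⟩ := isCompact_univ.ultrafilter_le_nhds' ((hyperfilter ℕ).map ν) univ_mem
  have hlim (f : C(X, ℝ)) : Tendsto (fun n => birkhoffAverage ℝ T f (n + 1) x₀)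
      (hyperfilter ℕ : Filter ℕ) (𝓝 (∫ x, f x ∂(μ : Measure X))) := by
    simpa [ν, integral_empiricalMeasure] using
      ProbabilityMeasure.tendsto_iff_forall_integral_tendsto.1 hμ (.mkOfCompact f)
  have hinv (f : C(X, ℝ)) : ∫ x, f (T x) ∂(μ : Measure X) = ∫ x, f x ∂(μ : Measure X) := by
    have hdiff := (tendsto_birkhoffAverage_apply_sub_birkhoffAverage' (𝕜 := ℝ)
      (isCompact_range f.continuous).isBounded T x₀).comp (tendsto_add_atTop_nat 1)
    refine sub_eq_zero.1 (tendsto_nhds_unique ?_ (hdiff.mono_left Nat.hyperfilter_le_atTop))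
    have hcomp (n : ℕ) : birkhoffAverage ℝ T (f.comp ⟨T, hT⟩) n x₀ =
        birkhoffAverage ℝ T f n (T x₀) := by
      simp only [birkhoffAverage, birkhoffSum, ← Function.iterate_succ_apply]
      simp [Function.iterate_succ_apply']
    simpa only [Function.comp_def, hcomp, ContinuousMap.comp_apply, ContinuousMap.coe_mk] using
      (hlim (f.comp ⟨T, hT⟩)).sub (hlim f)
  refine ⟨μ, inferInstance, hT.measurable, ?_⟩
  have := Measure.isProbabilityMeasure_map (μ := (μ : Measure X)) hT.measurable.aemeasurable
  refine ext_of_forall_integral_eq_of_IsFiniteMeasure fun f => ?_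
  rw [integral_map hT.measurable.aemeasurable f.continuous.aestronglyMeasurable]
  exact hinv f.toContinuousMap

theorem isUniquelyErgodic_of_tendstoUniformly [Nonempty X] (hT : Continuous T)
    (h : ∀ f : C(X, ℝ), TendstoUniformly (fun n (q : X × X) =>
      birkhoffAverage ℝ T f n q.1 - birkhoffAverage ℝ T f n q.2) 0 atTop) :
    IsUniquelyErgodic T := by
  obtain ⟨μ, hμ, hμT⟩ := exists_isProbabilityMeasure_measurePreserving hT
  refine ⟨μ, ⟨hμ, hμT⟩, ?_⟩
  rintro ν ⟨hν, hνT⟩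
  obtain ⟨x₀⟩ := ‹Nonempty X›
  refine ext_of_forall_integral_eq_of_IsFiniteMeasure fun f => ?_
  have hx₀ := (h f.toContinuousMap).comp fun x => (x, x₀)
  exact tendsto_nhds_unique (tendsto_birkhoffAverage_integral hT hνT hx₀)
    (tendsto_birkhoffAverage_integral hT hμT hx₀)

end UniqueErgodicity

/-! ### Averages of periodic sequences -/

section PeriodicAverages

/-- The sequence `z` has mean zero along every arithmetic progression. -/
def HasZeroMeans (z : ℕ → ℝ) : Prop :=
  ∀ t l, 0 < t → Tendsto (fun n : ℕ => (n : ℝ)⁻¹ * ∑ i ∈ Finset.range n, z (i * t + l)) atTop (𝓝 0)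

theorem IsAperiodicSeq.exists_hasZeroMeans {y : ℕ → ℝ} (hy : IsAperiodicSeq y) :
    ∃ C, ∃ z : ℕ → ℝ, (∀ j, |z j| ≤ 1) ∧ HasZeroMeans z ∧ ∀ j, y (j + 1) = C * z j := by
  obtain ⟨⟨C, hC⟩, hy⟩ := hy
  have hC0 : 0 < |C| + 1 := by positivity
  have hyC (j : ℕ) : |y (j + 1)| ≤ |C| + 1 := by
    linarith [hC (j + 1) (by omega), le_abs_self C]
  refine ⟨|C| + 1, fun j => (|C| + 1)⁻¹ * y (j + 1), fun j => ?_, fun t l ht => ?_,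
    fun j => (mul_inv_cancel_left₀ hC0.ne' _).symm⟩
  · rw [abs_mul, abs_inv, abs_of_pos hC0]
    exact inv_mul_le_one_of_le₀ (hyC j) hC0.le
  · have hbdd : Bornology.IsBounded (Set.range fun i => y (i * t + l + 1)) :=
      isBounded_iff_forall_norm_le.2 ⟨|C| + 1, Set.forall_mem_range.2 fun i => hyC _⟩
    have hdiff := tendsto_birkhoffAverage_apply_sub_birkhoffAverage' (𝕜 := ℝ) hbdd Nat.succ 0
    have hmean := ((hy t (l + 1) ht).sub hdiff).const_mul (|C| + 1)⁻¹
    rw [sub_zero, mul_zero] at hmean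
    refine hmean.congr fun n => ?_
    simp only [birkhoffAverage, birkhoffSum, Nat.succ_iterate, ← Finset.Ico_add_one_right_eq_Icc,
      Finset.sum_Ico_eq_sum_range, ← Finset.mul_sum, smul_eq_mul]
    simp [add_assoc]
    ring

variable {F : ℕ → ℝ} {p : ℕ}

theorem tendstoUniformly_average_of_periodic (hp : 0 < p) (hF : Function.Periodic F p)
    (hF01 : ∀ j, F j ∈ Set.Icc 0 1) :
    TendstoUniformly (fun (n a : ℕ) => (n : ℝ)⁻¹ * ∑ j ∈ Finset.range n, F (j + a))
      (fun _ => 𝔼 j ∈ Finset.range p, F j) atTop := by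
  set c := 𝔼 j ∈ Finset.range p, F j
  obtain ⟨hc₀, hc₁⟩ : c ∈ Set.Icc 0 1 := expect_mem_Icc fun j _ => hF01 j
  have hsum (n a : ℕ) : |∑ j ∈ Finset.range n, (F (j + a) - c)| ≤ 2 * p := by
    have hmod := Nat.mod_lt a hp
    have hwin (s : ℕ) : ∑ j ∈ Finset.range p, (F (p - a % p + s * p + j + a) - c) = 0 := by
      have hshift (j : ℕ) : F (p - a % p + s * p + j + a) = F j := by
        have h : p - a % p + s * p + j + a = j + (1 + s + a / p) * p := by
          have := Nat.div_add_mod' a p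
          rw [add_mul, add_mul]
          omega
        rw [h]
        exact_mod_cast hF.nat_mul _ j
      simp only [hshift, Finset.sum_sub_distrib, Finset.sum_const, c]
      rw [Finset.card_smul_expect, sub_self]
    have := abs_sum_range_le_of_windows (n := n) (δ := 0) hp
      (fun j => abs_sub_le_of_nonneg_of_le (hF01 (j + a)).1 (hF01 (j + a)).2 hc₀ hc₁)
      (Nat.sub_le p (a % p)) le_rfl fun s _ => by simp [hwin]
    simpa using this
  rw [Metric.tendstoUniformly_iff]
  intro ε hε
  have hlim := tendsto_const_div_atTop_nhds_zero_nat (2 * p : ℝ)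
  filter_upwards [hlim.eventually_lt_const hε, eventually_gt_atTop 0] with n hn hn0 a
  have hn0 : (0 : ℝ) < n := by exact_mod_cast hn0
  have hdiff : (n : ℝ)⁻¹ * ∑ j ∈ Finset.range n, F (j + a) - c =
      (n : ℝ)⁻¹ * ∑ j ∈ Finset.range n, (F (j + a) - c) := by
    rw [Finset.sum_sub_distrib, Finset.sum_const, Finset.card_range, nsmul_eq_mul]
    field_simp
  rw [dist_comm, Real.dist_eq, hdiff, abs_mul, abs_inv, Nat.abs_cast, inv_mul_eq_div]
  exact (div_le_div_of_nonneg_right (hsum n a) hn0.le).trans_lt hn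

variable {z : ℕ → ℝ}

theorem abs_average_mul_of_periodic_le (hp : 0 < p) (hF : Function.Periodic F p)
    (hF1 : ∀ j, |F j| ≤ 1) (hz : ∀ j, |z j| ≤ 1) (n : ℕ) :
    |(n : ℝ)⁻¹ * ∑ j ∈ Finset.range n, F j * z j| ≤ p / n +
      ∑ t ∈ Finset.range p, |((n / p : ℕ) : ℝ)⁻¹ * ∑ i ∈ Finset.range (n / p), z (i * p + t)| := by
  set M := n / p
  have hcols : |∑ j ∈ Finset.range (M * p), F j * z j| ≤
      ∑ t ∈ Finset.range p, |∑ i ∈ Finset.range M, z (i * p + t)| := by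
    rw [sum_range_mul, Finset.sum_comm]
    refine (Finset.abs_sum_le_sum_abs _ _).trans (Finset.sum_le_sum fun t _ => ?_)
    have hcol (i : ℕ) : F (i * p + t) = F t := by
      rw [add_comm]
      exact_mod_cast hF.nat_mul i t
    simp only [hcol, ← Finset.mul_sum, abs_mul]
    exact mul_le_of_le_one_left (abs_nonneg _) (hF1 t)
  have hrest : |∑ j ∈ Finset.range (n % p), F (M * p + j) * z (M * p + j)| ≤ p := by
    have hFz (j : ℕ) : |F j * z j| ≤ 1 := by
      rw [abs_mul]
      exact mul_le_one₀ (hF1 j) (abs_nonneg _) (hz j)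
    have hmod : ((n % p : ℕ) : ℝ) ≤ p := by exact_mod_cast (Nat.mod_lt n hp).le
    exact (abs_sum_range_le (fun j => hFz (M * p + j)) _).trans (by simpa using hmod)
  have hinv (t : ℕ) : (n : ℝ)⁻¹ * |∑ i ∈ Finset.range M, z (i * p + t)| ≤
      |(M : ℝ)⁻¹ * ∑ i ∈ Finset.range M, z (i * p + t)| := by
    rw [abs_mul, abs_inv, Nat.abs_cast]
    rcases M.eq_zero_or_pos with hM | hM
    · simp [hM]
    · have hMn : M ≤ n := Nat.div_le_self n p
      gcongr
  calc |(n : ℝ)⁻¹ * ∑ j ∈ Finset.range n, F j * z j|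
      = (n : ℝ)⁻¹ * |∑ j ∈ Finset.range (M * p + n % p), F j * z j| := by
        rw [abs_mul, abs_inv, Nat.abs_cast, Nat.div_add_mod']
    _ ≤ (n : ℝ)⁻¹ * (∑ t ∈ Finset.range p, |∑ i ∈ Finset.range M, z (i * p + t)| + p) := by
        rw [Finset.sum_range_add]
        gcongr
        exact (abs_add_le _ _).trans (add_le_add hcols hrest)
    _ = p / n + ∑ t ∈ Finset.range p, (n : ℝ)⁻¹ * |∑ i ∈ Finset.range M, z (i * p + t)| := by
        rw [mul_add, Finset.mul_sum, div_eq_inv_mul, add_comm]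
    _ ≤ _ := by gcongr with t; exact hinv t

theorem tendstoUniformly_average_mul_of_periodic (hp : 0 < p) (hF : Function.Periodic F p)
    (hF1 : ∀ j, |F j| ≤ 1) (hz : ∀ j, |z j| ≤ 1) (hz0 : HasZeroMeans z) :
    TendstoUniformly (fun (n a : ℕ) => (n : ℝ)⁻¹ * ∑ j ∈ Finset.range n, F (j + a) * z j)
      (fun _ => 0) atTop := by
  have hdiv : Tendsto (fun n => n / p) atTop atTop := Nat.tendsto_div_const_atTop hp.ne'
  have hlim := (tendsto_const_div_atTop_nhds_zero_nat (p : ℝ)).add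
    (tendsto_finsetSum (Finset.range p) fun t _ => ((hz0 p t hp).comp hdiv).abs)
  simp only [abs_zero, Finset.sum_const_zero, add_zero] at hlim
  rw [Metric.tendstoUniformly_iff]
  intro ε hε
  filter_upwards [hlim.eventually_lt_const hε] with n hn a
  rw [dist_zero_left]
  exact (abs_average_mul_of_periodic_le hp (hF.add_const a) (fun j => hF1 _) hz n).trans_lt hn

end PeriodicAverages

/-! ### The subshift of a scheme -/

namespace BlockScheme

variable {A : Type*} [Fintype A] (S : BlockScheme A)

/-- The pair of the word `w` and the weight `z` is among the tests of the scheme. -/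
def Tests (w : List A) (z : ℕ → ℝ) : Prop :=
  ∃ l, (S.test l).word = w ∧ (S.test l).weight = z

theorem eventually_div_period_lt (r : ℝ) {δ : ℝ} (hδ : 0 < δ) :
    ∀ᶠ k in atTop, r / S.period k < δ :=
  ((tendsto_const_div_atTop_nhds_zero_nat r).comp
    S.period_strictMono.tendsto_atTop).eventually_lt_const hδ

variable [Inhabited A]

theorem eventually_abs_average_sub_lt {l k : ℕ} (hlk : l ≤ k) {c : ℝ}
    (hc : TendstoUniformly (fun (n a : ℕ) => (n : ℝ)⁻¹ *
      ∑ j ∈ Finset.range n, S.freq (S.test l).word k (j + a) * (S.test l).weight j)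
      (fun _ => c) atTop) :
    ∀ᶠ n : ℕ in atTop, ∀ x ∈ S.points, |(n : ℝ)⁻¹ *
      ∑ j ∈ Finset.range n, wordInd (S.test l).word (shift j x) * (S.test l).weight j - c| <
        6 * ((S.test l).word.length + 1) / S.period k := by
  have hk0 : (0 : ℝ) < S.period k := by exact_mod_cast S.period_pos k
  set t := S.test l
  filter_upwards [Metric.tendstoUniformly_iff.1 hc (((t.word.length : ℝ) + 1) / S.period k)
    (by positivity), eventually_ge_atTop (S.period (k + 1) ^ 2), eventually_gt_atTop 0]
    with n hn hnk hn0 x hx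
  have hn0 : (0 : ℝ) < n := by exact_mod_cast hn0
  obtain ⟨a, ha⟩ := S.exists_abs_sum_discrepancy_le hlk hx hnk
  have hdiff : |(n : ℝ)⁻¹ * ∑ j ∈ Finset.range n, wordInd t.word (shift j x) * t.weight j -
      (n : ℝ)⁻¹ * ∑ j ∈ Finset.range n, S.freq t.word k (j + a) * t.weight j| ≤
      5 * (t.word.length + 1) / S.period k := by
    rw [← mul_sub, ← Finset.sum_sub_distrib, abs_mul, abs_inv, Nat.abs_cast]
    simp only [← sub_mul]
    exact inv_mul_le_of_le_mul₀ hn0.le (by positivity) ha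
  have hmean := hn a
  rw [dist_comm, Real.dist_eq] at hmean
  calc _ < 5 * ((t.word.length : ℝ) + 1) / S.period k + (t.word.length + 1) / S.period k :=
        (abs_sub_le _ _ _).trans_lt (add_lt_add_of_le_of_lt hdiff hmean)
    _ = 6 * (t.word.length + 1) / S.period k := by ring

theorem tendstoUniformly_average_mul {w : List A} {z : ℕ → ℝ} (hw : S.Tests w z)
    (hz : HasZeroMeans z) :
    TendstoUniformly (fun (n : ℕ) (x : S.points) =>
      (n : ℝ)⁻¹ * ∑ j ∈ Finset.range n, wordInd w (shift j x.1) * z j) 0 atTop := by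
  obtain ⟨l, rfl, rfl⟩ := hw
  rw [Metric.tendstoUniformly_iff]
  intro δ hδ
  obtain ⟨k, hk, hlk⟩ := ((S.eventually_div_period_lt (6 * ((S.test l).word.length + 1)) hδ).and
    (eventually_ge_atTop l)).exists
  have hfreq := tendstoUniformly_average_mul_of_periodic (S.period_pos k)
    (S.freq_periodic (S.test l).word k) (fun j => abs_le.2
      ⟨by linarith [(S.freq_mem_Icc (S.test l).word k j).1], (S.freq_mem_Icc _ k j).2⟩)
    (S.test l).abs_weight_le_one hz
  filter_upwards [S.eventually_abs_average_sub_lt hlk hfreq] with n hn x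
  simpa using (hn x.1 x.2).trans hk

theorem tendstoUniformly_average_sub_average {w : List A} (hw : S.Tests w 1) :
    TendstoUniformly (fun (n : ℕ) (q : S.points × S.points) =>
      (n : ℝ)⁻¹ * ∑ j ∈ Finset.range n, wordInd w (shift j q.1.1) -
        (n : ℝ)⁻¹ * ∑ j ∈ Finset.range n, wordInd w (shift j q.2.1)) 0 atTop := by
  obtain ⟨l, rfl, hone⟩ := hw
  rw [Metric.tendstoUniformly_iff]
  intro δ hδ
  obtain ⟨k, hk, hlk⟩ := ((S.eventually_div_period_lt (6 * ((S.test l).word.length + 1))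
    (half_pos hδ)).and (eventually_ge_atTop l)).exists
  have hfreq := tendstoUniformly_average_of_periodic (S.period_pos k)
    (S.freq_periodic (S.test l).word k) (S.freq_mem_Icc _ k)
  filter_upwards [S.eventually_abs_average_sub_lt (c := S.meanFreq (S.test l).word k) hlk
    (by simp only [hone, Pi.one_apply, mul_one]; exact hfreq)] with n hn q
  have h₁ := (hn q.1 q.1.2).trans hk
  have h₂ := (hn q.2 q.2.2).trans hk
  simp only [hone, Pi.one_apply, mul_one] at h₁ h₂
  rw [abs_sub_comm] at h₂
  rw [Pi.zero_apply, dist_zero_left, Real.norm_eq_abs]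
  exact (abs_sub_le _ _ _).trans_lt ((add_lt_add h₁ h₂).trans_eq (add_halves δ))

section Carrier

variable [TopologicalSpace A] [DiscreteTopology A]

theorem isClosed_points : IsClosed S.points := by
  refine isClosed_of_closure_subset fun x hx n => ?_
  obtain ⟨x', hx', h'⟩ := mem_closure_iff.1 hx _ (isOpen_cylinder (Finset.range n) x) fun i _ => rfl
  obtain ⟨m, b, hb, t, ht, h⟩ := h' n
  exact ⟨m, b, hb, t, ht, fun i hi => (hx' i (Finset.mem_range.2 hi)).symm.trans (h hi)⟩

theorem points_nonempty : S.points.Nonempty := by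
  choose b hb using S.blocks_nonempty
  obtain ⟨x, hx⟩ := exists_clusterPt_of_compactSpace (map b atTop)
  refine ⟨x, fun n => ?_⟩
  obtain ⟨m, hm, h⟩ := frequently_atTop.1 (mapClusterPt_iff_frequently.1 hx _
    ((isOpen_cylinder (Finset.range n) x).mem_nhds fun i _ => rfl)) n
  refine ⟨m, b m, hb m, 0, ?_, fun i hi => ?_⟩
  · have := S.lt_period m
    omega
  · rw [shift_zero]
    exact (h i (Finset.mem_range.2 hi)).symm

/-- The points of the scheme, as a subshift. -/
def subshift : Subshift A ℕ where
  carrier := S.points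
  isClosed := S.isClosed_points
  mapsTo g _ hx := S.shift_mem_points hx g

end Carrier

theorem exists_eqOn_shift (hone : ∀ w, S.Tests w 1) {n m t : ℕ} {b : ℕ → A} (hb : b ∈ S.blocks m)
    (ht : t + n ≤ S.period m) {x : ℕ → A} (hx : x ∈ S.points) :
    ∃ i, Set.EqOn (shift i x) (shift t b) (Set.Iio n) := by
  classical
  rcases n.eq_zero_or_pos with rfl | hn
  · exact ⟨0, by simp [Set.eqOn_empty]⟩
  obtain ⟨l, hw, hl⟩ := hone (List.ofFn fun i : Fin n => shift t b i)
  have hhit : wordHits (S.test l).word (S.period m) b t = 1 := by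
    rw [wordHits, if_pos (by simpa [hw] using ht), hw, wordInd_ofFn, if_pos rfl]
  obtain ⟨i, hi⟩ := S.exists_startsWith_of_mem_points (fun j => congrFun hl j) hb (by omega) hhit hx
  rw [hw] at hi
  exact ⟨i, fun j hj => by simpa using hi j (by simpa using hj)⟩

variable [UniformSpace A] [DiscreteUniformity A]

theorem isMinimalSystem_subshift (hone : ∀ w, S.Tests w 1) :
    IsMinimalSystem (subshiftMap S.subshift) := by
  refine ⟨S.points_nonempty.to_subtype, fun C hC hCT => or_iff_not_imp_left.2 fun hne => ?_⟩
  obtain ⟨x', hx'⟩ := Set.nonempty_iff_ne_empty.2 hne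
  refine Set.eq_univ_of_forall fun x => hC.closure_subset
    (UniformSpace.mem_closure_iff_ball.2 fun {U} hU => ?_)
  obtain ⟨n, hn⟩ := exists_forall_eqOn_mem_of_mem_uniformity hU
  obtain ⟨m, b, hb, t, ht, hxb⟩ := x.2 n
  obtain ⟨i, hi⟩ := S.exists_eqOn_shift hone hb ht x'.2
  refine ⟨(subshiftMap S.subshift)^[i] x', hn _ _ ?_, hCT.iterate i hx'⟩
  rw [subshiftMap_iterate_val]
  exact hxb.trans hi.symm

theorem isUniquelyErgodic_subshift [MeasurableSpace S.subshift.carrier]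
    [BorelSpace S.subshift.carrier] (hone : ∀ w, S.Tests w 1) :
    IsUniquelyErgodic (subshiftMap S.subshift) := by
  have : Nonempty S.subshift.carrier := S.points_nonempty.to_subtype
  refine isUniquelyErgodic_of_tendstoUniformly (continuous_subshiftMap _) fun f => ?_
  have hword (w : List A) := S.tendstoUniformly_average_sub_average (hone w)
  simpa [weightedAverage_apply, birkhoffAverage, birkhoffSum] using
    tendstoUniformly_weightedAverage_sub (S := S.subshift) (z := fun _ => 1) (by simp)
      (fun w => by simp only [mul_one]; exact hword w) f

theorem uniformlyUncorrelated_subshift {y z : ℕ → ℝ} {C : ℝ} (hy : ∀ j, y (j + 1) = C * z j)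
    (hz : HasZeroMeans z) (htest : ∀ w, S.Tests w z) :
    UniformlyUncorrelated (subshiftMap S.subshift) y := by
  intro f
  have hz1 (j : ℕ) : |z j| ≤ 1 := by
    obtain ⟨l, -, rfl⟩ := htest []
    exact (S.test l).abs_weight_le_one j
  have hf := tendstoUniformly_weightedAverage (S := S.subshift) hz1
    (fun w => S.tendstoUniformly_average_mul (htest w) hz) f
  have hCf := ((uniformContinuous_const_smul C).comp_tendstoUniformly hf).comp
    (subshiftMap S.subshift)
  simp only [Function.comp_def, Pi.zero_apply, smul_zero] at hCf
  refine (tendstoUniformly_congr (.of_forall fun n => funext fun x => ?_)).1 hCf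
  simp only [weightedAverage_apply, ← Finset.Ico_add_one_right_eq_Icc,
    Finset.sum_Ico_eq_sum_range, Nat.add_sub_cancel, add_comm 1, hy, Function.iterate_succ_apply,
    smul_eq_mul, one_div, Finset.mul_sum]
  exact Finset.sum_congr rfl fun j _ => by ring

end BlockScheme

/-! ### Entropy -/

section Entropy

open Dynamics ExpGrowth Uniformity

variable {A : Type*}

theorem exists_finset_forall_exists_eqOn [Fintype A] (C : Set (ℕ → A)) (m : ℕ) :
    ∃ s : Finset C, s.card ≤ Fintype.card A ^ m ∧
      ∀ x : C, ∃ x' ∈ s, Set.EqOn x.1 x'.1 (Set.Iio m) := by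
  classical
  set φ : C → Fin m → A := fun x i => x.1 i
  refine ⟨Finset.univ.image (Set.rangeSplitting φ), ?_, fun x =>
    ⟨_, Finset.mem_image_of_mem _ (Finset.mem_univ ⟨φ x, x, rfl⟩), fun i hi => ?_⟩⟩
  · calc _ ≤ Fintype.card (Set.range φ) := Finset.card_image_le
      _ ≤ Fintype.card (Fin m → A) := Fintype.card_subtype_le _
      _ = Fintype.card A ^ m := by rw [Fintype.card_fun, Fintype.card_fin]
  · exact congrFun (Set.apply_rangeSplitting φ ⟨φ x, x, rfl⟩).symm ⟨i, hi⟩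

variable [UniformSpace A] [DiscreteUniformity A] (S : Subshift A ℕ)

theorem coverEntropy_subshiftMap_le [Fintype A] :
    coverEntropy (subshiftMap S) Set.univ ≤ ENNReal.log (Fintype.card A) := by
  refine iSup₂_le fun U hU => ?_
  obtain ⟨r, hr⟩ := exists_forall_eqOn_mem_of_mem_uniformity hU
  rw [coverEntropyEntourage, ← expGrowthSup_pow]
  refine expGrowthSup_le_of_eventually_le (b := (Fintype.card A : ENNReal) ^ r)
    (ENNReal.pow_ne_top (ENNReal.natCast_ne_top _)) (.of_forall fun n => ?_)
  obtain ⟨s, hcard, hs⟩ := exists_finset_forall_exists_eqOn S.carrier (r + n)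
  have hcover : IsDynCoverOf (subshiftMap S) Set.univ U n (s : Set S.carrier) := by
    intro x _
    obtain ⟨x', hx', h⟩ := hs x
    refine ⟨x', hx', mem_dynEntourage.2 fun k hk => hr _ _ fun i hi => ?_⟩
    rw [subshiftMap_iterate_val, subshiftMap_iterate_val, shift_apply, shift_apply]
    exact h (show k + i < r + n by have hi : i < r := hi; omega)
  calc (coverMincard (subshiftMap S) Set.univ U n : ENNReal)
      ≤ ((Fintype.card A ^ (r + n) : ℕ) : ℕ∞) := by
        exact_mod_cast hcover.coverMincard_le_card.trans (Nat.cast_le.2 hcard)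
    _ = (Fintype.card A : ENNReal) ^ r * (Fintype.card A : ENNReal) ^ n := by simp [pow_add]

variable {S}

theorem le_coverEntropy_subshiftMap {h : ℝ} (hs : ∃ᶠ n : ℕ in atTop, ∃ s : Finset S.carrier,
      (s : Set S.carrier).Pairwise (fun x x' => ¬ Set.EqOn x.1 x'.1 (Set.Iio n)) ∧
      Real.exp (h * n) ≤ s.card) :
    (h : EReal) ≤ coverEntropy (subshiftMap S) Set.univ := by
  set U : Set (S.carrier × S.carrier) := {q | q.1.1 0 = q.2.1 0}
  have hU : U ∈ 𝓤 S.carrier :=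
    ((Pi.uniformContinuous_proj (fun _ : ℕ => A) 0).comp uniformContinuous_subtype_val)
      (DiscreteUniformity.relId_mem_uniformity A)
  refine le_trans (Frequently.le_expGrowthSup (hs.mono ?_))
    (netEntropyEntourage_le_coverEntropy (subshiftMap S) Set.univ hU)
  rintro n ⟨s, hinj, hcard⟩
  have hnet : IsDynNetIn (subshiftMap S) Set.univ U n (s : Set S.carrier) := by
    refine ⟨Set.subset_univ _, fun x hx x' hx' hne => Set.disjoint_left.2 fun z hz hz' => ?_⟩
    refine hinj hx hx' hne fun i hi => ?_
    have hxz := mem_dynEntourage.1 hz i hi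
    have hxz' := mem_dynEntourage.1 hz' i hi
    simp only [U, Set.mem_ofPred_eq, subshiftMap_iterate_val, shift_apply, add_zero] at hxz hxz'
    exact hxz.trans hxz'.symm
  calc EReal.exp (h * n) = ENNReal.ofReal (Real.exp (h * n)) := by
        rw [← EReal.exp_coe]; push_cast; rfl
    _ ≤ ENNReal.ofReal (s.card : ℝ) := ENNReal.ofReal_le_ofReal hcard
    _ = ((s.card : ℕ∞) : ENNReal) := by simp
    _ ≤ _ := by exact_mod_cast hnet.card_le_netMaxcard

end Entropy

namespace BlockScheme

variable {A : Type*} [Fintype A] [Inhabited A] (S : BlockScheme A)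

-- The additive constant absorbs the loss of the factor `1 - defect k` at each level.
theorem exp_le_card_blocks (k : ℕ) :
    Real.exp ((Real.log (Fintype.card A) - 2 / S.base) * S.period k + 2) ≤
      (S.blocks k).card := by
  have hbase : (0 : ℝ) < S.base := by exact_mod_cast (by have := S.le_base; omega : 0 < S.base)
  have hA0 : (0 : ℝ) < Fintype.card A := by exact_mod_cast Fintype.card_pos
  induction k with
  | zero =>
    have hexp : (Real.log (Fintype.card A) - 2 / S.base) * S.period 0 + 2 =
        S.base * Real.log (Fintype.card A) := by
      rw [period, pow_zero, pow_one]; field_simp; ring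
    rw [hexp, card_blocks_zero, Real.exp_nat_mul, Real.exp_log hA0]
    push_cast
    exact le_rfl
  | succ k ih =>
    have hp : (1 : ℝ) ≤ S.period k := by exact_mod_cast S.period_pos k
    let E : ℝ := (Real.log (Fintype.card A) - 2 / S.base) * S.period k + 2
    have hexp : Real.exp (-1) ≤ 1 - S.defect k := by
      linarith [Real.exp_neg_one_lt_half, S.defect_le_half k]
    have hp4 : (3 : ℝ) / 2 ≤ S.period k ^ 4 := by
      have : (106 : ℝ) ≤ S.period k := by exact_mod_cast S.le_period k
      calc (3 : ℝ) / 2 ≤ S.period k := by linarith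
        _ ≤ S.period k ^ 4 := le_self_pow₀ hp (by norm_num)
    calc Real.exp ((Real.log (Fintype.card A) - 2 / S.base) * S.period (k + 1) + 2)
        = Real.exp (S.period k ^ 4 * E + (2 - 2 * S.period k ^ 4)) := by
          simp only [E]
          congr 1
          rw [period_succ]
          push_cast
          ring
      _ ≤ Real.exp (-1 + (S.period k ^ 4 : ℕ) * E) := by
          refine Real.exp_le_exp.2 ?_
          push_cast
          linarith
      _ = Real.exp (-1) * Real.exp E ^ (S.period k ^ 4) := by
          rw [Real.exp_add, Real.exp_nat_mul]
      _ ≤ (1 - S.defect k) * ((S.blocks k).card : ℝ) ^ (S.period k ^ 4) := by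
          gcongr
          exact (Real.exp_pos _).le.trans hexp
      _ ≤ (S.blocks (k + 1)).card := S.le_card_blocks_succ k

theorem exists_finset_pairwise_not_eqOn (hone : ∀ w, S.Tests w 1) (k : ℕ)
    [TopologicalSpace A] [DiscreteTopology A] :
    ∃ s : Finset S.points, (s : Set S.points).Pairwise
      (fun x x' => ¬ Set.EqOn x.1 x'.1 (Set.Iio (S.period k))) ∧ s.card = (S.blocks k).card := by
  classical
  obtain ⟨x, hx⟩ := S.points_nonempty
  have hext (b : S.blocks k) : ∃ x' : S.points, Set.EqOn x'.1 b.1 (Set.Iio (S.period k)) := by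
    obtain ⟨i, hi⟩ := S.exists_eqOn_shift hone (n := S.period k) (t := 0) b.2 (by simp) hx
    exact ⟨⟨_, S.shift_mem_points hx i⟩, by simpa using hi⟩
  choose g hg using hext
  have hinj {b b' : S.blocks k} (h : Set.EqOn (g b).1 (g b').1 (Set.Iio (S.period k))) : b = b' :=
    Subtype.ext (S.blocks_ext b.2 b'.2 (((hg b).symm.trans h).trans (hg b')))
  refine ⟨Finset.univ.image g, ?_, ?_⟩
  · simp only [Finset.coe_image, Finset.coe_univ, Set.image_univ]
    rintro _ ⟨b, rfl⟩ _ ⟨b', rfl⟩ hne h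
    exact hne (congrArg g (hinj h))
  · rw [Finset.card_image_of_injective _ fun b b' h => hinj fun i _ => by rw [h]]
    simp

variable [UniformSpace A] [DiscreteUniformity A]

theorem le_coverEntropy_subshift (hone : ∀ w, S.Tests w 1) :
    ((Real.log (Fintype.card A) - 2 / S.base : ℝ) : EReal) ≤
      Dynamics.coverEntropy (subshiftMap S.subshift) Set.univ := by
  refine le_coverEntropy_subshiftMap (S.period_strictMono.tendsto_atTop.frequently
    (.of_forall fun k => ?_))
  obtain ⟨s, hs, hcard⟩ := S.exists_finset_pairwise_not_eqOn hone k
  refine ⟨s, hs, ?_⟩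
  calc Real.exp ((Real.log (Fintype.card A) - 2 / S.base) * S.period k)
      ≤ Real.exp ((Real.log (Fintype.card A) - 2 / S.base) * S.period k + 2) :=
        Real.exp_le_exp.2 (by linarith)
    _ ≤ (S.blocks k).card := S.exp_le_card_blocks k
    _ = s.card := congrArg Nat.cast hcard.symm

end BlockScheme

theorem BlockScheme.exists_tests {A ι : Type*} [Fintype A] [Countable ι] (z : ι → ℕ → ℝ)
    (hz : ∀ i j, |z i j| ≤ 1) (r : ℕ) :
    ∃ S : BlockScheme A, r ≤ S.base ∧ (∀ w, S.Tests w 1) ∧ ∀ w i, S.Tests w (z i) := by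
  let test : List A × Option ι → WordTest A
    | (w, none) => ⟨w, 1, fun j => by simp⟩
    | (w, some i) => ⟨w, z i, hz i⟩
  obtain ⟨e, he⟩ := exists_surjective_nat (List A × Option ι)
  refine ⟨⟨max r (2 * (53 + Fintype.card A)), le_max_right _ _, test ∘ e⟩, le_max_left _ _,
    fun w => ?_, fun w i => ?_⟩
  · obtain ⟨l, hl⟩ := he (w, none)
    exact ⟨l, by simp [hl, test]⟩
  · obtain ⟨l, hl⟩ := he (w, some i)
    exact ⟨l, by simp [hl, test]⟩

theorem theorem2_general {A ι : Type*} [Fintype A] [Nonempty A] [UniformSpace A]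
    [DiscreteUniformity A] [MeasurableSpace A] [BorelSpace A] [Countable ι] (y : ι → ℕ → ℝ)
    (hy : ∀ i, IsAperiodicSeq (y i)) (ε : ℝ) (hε : 0 < ε) :
    ∃ S : Subshift A ℕ,
      IsStrictlyErgodic (subshiftMap S) ∧
      ((Real.log (Fintype.card A) - ε : ℝ) : EReal) <
        Dynamics.coverEntropy (subshiftMap S) Set.univ ∧
      Dynamics.coverEntropy (subshiftMap S) Set.univ ≤ Real.log (Fintype.card A) ∧
      ∀ i, UniformlyUncorrelated (subshiftMap S) (y i) := by
  have : Inhabited A := Classical.inhabited_of_nonempty ‹_›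
  choose C z hz hmean hyz using fun i => (hy i).exists_hasZeroMeans
  obtain ⟨r, hr⟩ := exists_nat_gt (2 / ε)
  obtain ⟨S, hrS, hone, htest⟩ := BlockScheme.exists_tests (A := A) z hz r
  have hbase : 2 / ε < S.base := hr.trans_le (Nat.cast_le.2 hrS)
  have hloss : 2 / (S.base : ℝ) < ε :=
    (div_lt_comm₀ hε ((div_pos two_pos hε).trans hbase)).1 hbase
  refine ⟨S.subshift, ⟨S.isMinimalSystem_subshift hone, S.isUniquelyErgodic_subshift hone⟩,
    ?_, ?_, fun i => S.uniformlyUncorrelated_subshift (hyz i) (hmean i) (htest · i)⟩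
  · exact (EReal.coe_lt_coe_iff.2 (sub_lt_sub_left hloss _)).trans_le
      (S.le_coverEntropy_subshift hone)
  · refine (coverEntropy_subshiftMap_le S.subshift).trans_eq ?_
    rw [← ENNReal.ofReal_natCast, ENNReal.log_ofReal_of_pos (Nat.cast_pos.2 Fintype.card_pos)]

theorem theorem2 (y : ℕ → ℝ) (hy : IsAperiodicSeq y) (N : ℕ) (hN : 2 ≤ N)
    (ε : ℝ) (hε : 0 < ε) :
    ∃ S : Subshift (Fin N) ℕ,
      IsStrictlyErgodic (subshiftMap S) ∧
      ((Real.log N - ε : ℝ) : EReal) < subshiftEntropy S ∧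
      subshiftEntropy S < ((Real.log N + ε : ℝ) : EReal) ∧
      UniformlyUncorrelated (subshiftMap S) y := by
  let : UniformSpace (Fin N) := ⊥
  have : NeZero N := ⟨by omega⟩
  obtain ⟨S, hS, hlower, hupper, hunc⟩ :=
    theorem2_general (A := Fin N) (fun _ : Unit => y) (fun _ => hy) ε hε
  rw [Fintype.card_fin] at hlower hupper
  exact ⟨S, hS, hlower, hupper.trans_lt (EReal.coe_lt_coe (lt_add_of_pos_right _ hε)), hunc ()⟩
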